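/- Let $n\ge 1$ and $d=2^n$. On $(\mathbb C^2)^{\otimes n}\cong\mathbb C^d$ let $X,Y,Z$ be the Pauli matrices and let, for $0\le j\le n-1$, $$\Gamma_{2j}=Y^{\otimes j}\otimes X\otimes \mathbb I^{\otimes(n-1-j)},\qquad \Gamma_{2j+1}=Y^{\otimes j}\otimes Z\otimes \mathbb I^{\otimes(n-1-j)},\qquad \Gamma_{2n}=i^{\,n}\,\Gamma_0\Gamma_1\cdots\Gamma_{2n-1}.$$ For $A=\{k_1<\dots<k_\ell\}\subseteq\{0,\dots,2n-1\}$ put $\Gamma_A=i^{\ell(\ell-1)/2}\,\Gamma_{k_1}\cdots\Gamma_{k_\ell}$ (a Hermitian unitary), and let $\mathcal S=\{\Gamma_A : A\subseteq\{0,\dots,2n-1\}\}$. Let $L$ be a prime with $2\le L\le 2n+1$ such that $L$ divides $n$ or $L=2n+1$. Then there exist a unitary $U$ on $\mathbb C^d$, sets $\mathcal C_0,\dots,\mathcal C_{L-1}\subseteq\mathcal S\setminus\{\mathbb I\}$ and orthonormal bases $\mathcal B_j=\{|b^{(j)}\rangle\}_{b=0}^{d-1}$ of $\mathbb C^d$,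 $0\le j\le L-1$, such that, with indices $j$ read modulo $L$: 1. $U$ cyclically permutes the generators under conjugation: if $L=2n+1$, then $U\Gamma_kU^\dagger=\Gamma_{(k+1)\bmod L}$ for $0\le k\le 2n$; if $L$ divides $n$, then $U\Gamma_{aL+c}U^\dagger=\Gamma_{aL+((c+1)\bmod L)}$ for $0\le a<2n/L$ and $0\le c<L$ (in particular $\Gamma_0\to\Gamma_1\to\dots\to\Gamma_{L-1}\to\Gamma_0$), and $U\Gamma_{2n}U^\dagger=\Gamma_{2n}$. 2. $|\mathcal C_j|=d-1$, the elements of $\mathcal C_j$ commute with each other, exactly one of $\Gamma_0,\dots,\Gamma_{2n}$ lies in $\mathcal C_j$, and $\mathcal C_j\cap\mathcal C_k=\emptyset$ for $j\ne k$. 3. $U$ permutes the classes: for every $P\in\mathcal C_j$, either $UPU^\dagger$ or $-UPU^\dagger$ lies in $\mathcal C_{j+1}$. 4. Every vector of $\mathcal B_j$ is an eigenvector of every element of $\mathcal C_j$. 5. The bases are mutually unbiased: $|\langle a^{(j)}|b^{(k)}\rangle|=1/\sqrt d$ for all $a,b$ and all $j\ne k$. 6. $U\mathcal B_j=\mathcal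 B_{j+1}$; more precisely $U|b^{(j)}\rangle=|b^{(j+1)}\rangle$ for all $b$ and $j$. -/

import Mathlib

namespace CyclicMUB

/-- The Pauli matrix `X`. -/
def pauliX : Matrix (Fin 2) (Fin 2) ℂ := !![0, 1; 1, 0]

/-- The Pauli matrix `Y`. -/
def pauliY : Matrix (Fin 2) (Fin 2) ℂ := !![0, -Complex.I; Complex.I, 0]

/-- The Pauli matrix `Z`. -/
def pauliZ : Matrix (Fin 2) (Fin 2) ℂ := !![1, 0; 0, -1]

/-- The Hilbert space `(ℂ²)^{⊗ n}` of `n` qubits, in the computational basis indexed by bit strings;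
its dimension is `d = 2 ^ n`. -/
abbrev Qubits (n : ℕ) : Type := EuclideanSpace ℂ (Fin n → Fin 2)

/-- Operators on `n` qubits, as matrices in the computational basis. -/
abbrev Op (n : ℕ) : Type := Matrix (Fin n → Fin 2) (Fin n → Fin 2) ℂ

/-- The tensor product `M₀ ⊗ M₁ ⊗ ⋯ ⊗ M_{n-1}` of single-qubit matrices. -/
def tensor {n : ℕ} (M : Fin n → Matrix (Fin 2) (Fin 2) ℂ) : Op n :=
  Matrix.of fun x y => ∏ m, M m (x m) (y m)

/-- The Jordan–Wigner generators: for `j < n`,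
`jordanWigner n (2j) = Y^{⊗ j} ⊗ X ⊗ 1^{⊗ (n-1-j)}` and
`jordanWigner n (2j+1) = Y^{⊗ j} ⊗ Z ⊗ 1^{⊗ (n-1-j)}`. -/
def jordanWigner (n k : ℕ) : Op n :=
  tensor fun m =>
    if (m : ℕ) < k / 2 then pauliY
    else if (m : ℕ) = k / 2 then (if k % 2 = 0 then pauliX else pauliZ)
    else 1

/-- The Clifford generators `Γ_0, …, Γ_{2n-1}`, and `Γ_{2n} = i^n Γ_0 Γ_1 ⋯ Γ_{2n-1}`.
Only the indices `k ≤ 2n` are meaningful. -/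
noncomputable def Γ (n k : ℕ) : Op n :=
  if k < 2 * n then jordanWigner n k
  else Complex.I ^ n • (List.ofFn fun i : Fin (2 * n) => jordanWigner n i).prod

/-- The product of the generators `Γ_k`, `k ∈ A ⊆ {0, …, 2n-1}`, in increasing order, with the phase
`i^{|A|(|A|-1)/2}` that makes it Hermitian. -/
noncomputable def cliffordProduct (n : ℕ) (A : Finset (Fin (2 * n))) : Op n :=
  Complex.I ^ (A.card.choose 2) •
    (List.ofFn fun k : Fin (2 * n) => if k ∈ A then Γ n k else 1).prod

/-- The set `𝒮 = {1, Γ_j, i Γ_j Γ_k, …, Γ_{2n}}` of all Clifford products. -/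
def cliffordProducts (n : ℕ) : Set (Op n) := Set.range (cliffordProduct n)

/-- The permutation of indices that cyclically permutes each of the consecutive blocks
`{aL, aL+1, …, aL+L-1}` of length `L`. -/
def blockShift (L k : ℕ) : ℕ := L * (k / L) + (k % L + 1) % L

/-- `U` cyclically permutes the generators by conjugation: if `L = 2n+1` it cycles through all of
`Γ_0, …, Γ_{2n}`; if `L ∣ n` it cycles through each of the `2n/L` consecutive blocks of `L`
generators among `Γ_0, …, Γ_{2n-1}` and leaves `Γ_{2n}` invariant. -/
def CyclesGenerators (n L : ℕ) (U : Op n) : Prop :=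
  (L = 2 * n + 1 → ∀ k < L, U * Γ n k * U.conjTranspose = Γ n ((k + 1) % L)) ∧
  (L ∣ n → (∀ k < 2 * n, U * Γ n k * U.conjTranspose = Γ n (blockShift L k)) ∧
    U * Γ n (2 * n) * U.conjTranspose = Γ n (2 * n))

/-- Two orthonormal bases of `(ℂ²)^{⊗ n}` are mutually unbiased. -/
def MutuallyUnbiased {n : ℕ} (B B' : OrthonormalBasis (Fin (2 ^ n)) ℂ (Qubits n)) : Prop :=
  ∀ a b, ‖inner ℂ (B a) (B' b)‖ = 1 / Real.sqrt ((2 : ℝ) ^ n)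

end CyclicMUB

-- The matrices Γ_0, …, Γ_{2n} are Hermitian, square to 1 and anticommute pairwise, and the product
-- of all of them is scalar. Up to phase, Clifford products are therefore subsets of the 2n+1
-- indices modulo complement; `ind A` describes the representative that omits 2n. All commutation
-- relations become arithmetic in `ZMod 2`: Γ_A and Γ_x commute up to the sign |A| + [x ∈ A], and
-- Γ_A and Γ_B up to |A||B| + |A ∩ B|. Distinct products are orthogonal for the trace, hence span
-- all matrices, so only scalars commute with every generator.
--
-- Unitary: the reflections (Γ_i − Γ_j)/√2 realise transpositions of the generators with a factor
-- −1, so every even permutation σ is implemented exactly (`exists_unitary_mul_Γ`). If σ^L = 1 then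
-- the L-th power of the unitary is a scalar, and a rescaling gives U^L = 1
-- (`exists_implements_pow_eq_one`). Conjugation by U permutes the Clifford products up to sign
-- (`Implements.conj_cliffordProduct`).
--
-- Classes: let τ be an involution of the 2n+1 indices with a single fixed point k. Its invariant
-- subsets, modulo complement, number 2^n. Their products commute, because pairs cancel in every
-- parity count, and Γ_k is the only generator among them. Conjugating τ by powers of σ gives the
-- other classes. Two classes meet only in the identity when a subset invariant under both
-- involutions must be empty or everything; this is the condition in `IsCyclicPairing`.
--
-- Bases: a common eigenvector v of 2^n such products satisfies |v⟩⟨v| = 2^{-n} ∑ μ_A Γ_A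
-- (`rankOne_eq_sum`). If two families share only the identity, trace orthogonality leaves a single
-- term, which gives unbiasedness (`norm_inner_of_inter_eq`). An eigenbasis of the first class is
-- moved around by the powers of U.
--
-- What remains is combinatorial: to find τ. For L = 2n+1 it is x ↦ −x on ℤ/L. For L = 2 it is a
-- chain linking the blocks. For odd L dividing n it is the reflection of each block, modified so
-- that the blocks and the extra point are linked together.

namespace CyclicMUB

open Matrix

/-! ### Tensor products of single-qubit matrices -/

theorem tensor_mul {n : ℕ} (M N : Fin n → Matrix (Fin 2) (Fin 2) ℂ) :
    tensor M * tensor N = tensor (fun m => M m * N m) := by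
  ext x y
  simp only [tensor, Matrix.mul_apply, Matrix.of_apply, ← Finset.prod_mul_distrib]
  rw [Finset.prod_univ_sum, Fintype.piFinset_univ]

theorem tensor_one {n : ℕ} : tensor (fun _ : Fin n => 1) = 1 := by
  ext x y
  simp only [tensor, Matrix.of_apply, Matrix.one_apply, Finset.prod_ite_zero]
  simp [funext_iff]

theorem conjTranspose_tensor {n : ℕ} (M : Fin n → Matrix (Fin 2) (Fin 2) ℂ) :
    (tensor M)ᴴ = tensor (fun m => (M m)ᴴ) := by
  ext x y
  simp [tensor, Matrix.conjTranspose_apply]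

theorem tensor_smul {n : ℕ} (s : Fin n → ℂ) (M : Fin n → Matrix (Fin 2) (Fin 2) ℂ) :
    tensor (fun m => s m • M m) = (∏ m, s m) • tensor M := by
  ext x y
  simp [tensor, Finset.prod_mul_distrib]

/-! ### The Jordan–Wigner generators -/

/-- The factor of the `k`-th Jordan–Wigner generator at the site `m`. -/
def jordanWignerFactor (k m : ℕ) : Matrix (Fin 2) (Fin 2) ℂ :=
  if m < k / 2 then pauliY
  else if m = k / 2 then (if k % 2 = 0 then pauliX else pauliZ)
  else 1

theorem pauliX_mul_self : pauliX * pauliX = 1 := by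
  ext i j; fin_cases i <;> fin_cases j <;> simp [pauliX]

theorem pauliY_mul_self : pauliY * pauliY = 1 := by
  ext i j; fin_cases i <;> fin_cases j <;> simp [pauliY]

theorem pauliZ_mul_self : pauliZ * pauliZ = 1 := by
  ext i j; fin_cases i <;> fin_cases j <;> simp [pauliZ]

theorem conjTranspose_pauliX : pauliXᴴ = pauliX := by
  ext i j; fin_cases i <;> fin_cases j <;> simp [pauliX]

theorem conjTranspose_pauliY : pauliYᴴ = pauliY := by
  ext i j; fin_cases i <;> fin_cases j <;> simp [pauliY]

theorem conjTranspose_pauliZ : pauliZᴴ = pauliZ := by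
  ext i j; fin_cases i <;> fin_cases j <;> simp [pauliZ]

theorem pauliX_mul_pauliZ : pauliX * pauliZ = (-1 : ℂ) • (pauliZ * pauliX) := by
  ext i j; fin_cases i <;> fin_cases j <;> simp [pauliX, pauliZ]

theorem pauliX_mul_pauliY : pauliX * pauliY = (-1 : ℂ) • (pauliY * pauliX) := by
  ext i j; fin_cases i <;> fin_cases j <;> simp [pauliX, pauliY]

theorem pauliZ_mul_pauliY : pauliZ * pauliY = (-1 : ℂ) • (pauliY * pauliZ) := by
  ext i j; fin_cases i <;> fin_cases j <;> simp [pauliZ, pauliY]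

theorem jordanWignerFactor_mul_self (k m : ℕ) :
    jordanWignerFactor k m * jordanWignerFactor k m = 1 := by
  unfold jordanWignerFactor
  split_ifs <;> simp [pauliX_mul_self, pauliY_mul_self, pauliZ_mul_self]

theorem conjTranspose_jordanWignerFactor (k m : ℕ) :
    (jordanWignerFactor k m)ᴴ = jordanWignerFactor k m := by
  unfold jordanWignerFactor
  split_ifs <;> simp [conjTranspose_pauliX, conjTranspose_pauliY, conjTranspose_pauliZ]

/-- Left of site k/2 both factors are Y, and right of it the first factor is 1. Only at k/2 itself
do two different Pauli matrices meet, so exactly one sign appears in the tensor product. -/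
theorem jordanWignerFactor_mul {k l : ℕ} (hkl : k < l) (m : ℕ) :
    jordanWignerFactor k m * jordanWignerFactor l m =
      (if m = k / 2 then (-1 : ℂ) else 1) • (jordanWignerFactor l m * jordanWignerFactor k m) := by
  rcases lt_trichotomy m (k / 2) with h | h | h
  · have h' : m < l / 2 := by omega
    simp [jordanWignerFactor, h, h', h.ne]
  · rcases Nat.lt_or_ge m (l / 2) with h' | h'
    · by_cases hk : k % 2 = 0
      · simp only [jordanWignerFactor, h', ← h, lt_irrefl, if_true, if_false, hk]
        exact pauliX_mul_pauliY
      · simp only [jordanWignerFactor, h', ← h, lt_irrefl, if_true, if_false, hk]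
        exact pauliZ_mul_pauliY
    · have h2 : m = l / 2 := by omega
      have hk : k % 2 = 0 := by omega
      have hl : l % 2 ≠ 0 := by omega
      simp only [jordanWignerFactor, ← h2, ← h, lt_irrefl, if_true, if_false, hk, hl]
      exact pauliX_mul_pauliZ
  · have h1 : ¬ m < k / 2 := by omega
    simp [jordanWignerFactor, h1, h.ne']

theorem jordanWigner_eq_tensor (n k : ℕ) :
    jordanWigner n k = tensor fun m => jordanWignerFactor k m := rfl

theorem jordanWigner_mul_self (n k : ℕ) : jordanWigner n k * jordanWigner n k = 1 := by
  simp [jordanWigner_eq_tensor, tensor_mul, jordanWignerFactor_mul_self, tensor_one]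

theorem conjTranspose_jordanWigner (n k : ℕ) : (jordanWigner n k)ᴴ = jordanWigner n k := by
  simp [jordanWigner_eq_tensor, conjTranspose_tensor, conjTranspose_jordanWignerFactor]

theorem jordanWigner_mul_of_lt {n k l : ℕ} (hkl : k < l) (hk : k < 2 * n) :
    jordanWigner n k * jordanWigner n l = -(jordanWigner n l * jordanWigner n k) := by
  have hk2 : k / 2 < n := by omega
  simp only [jordanWigner_eq_tensor, tensor_mul, jordanWignerFactor_mul hkl]
  rw [tensor_smul, Finset.prod_eq_single (⟨k / 2, hk2⟩ : Fin n)]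
  · simp
  · intro b _ hb
    rw [if_neg]
    rintro h
    exact hb (Fin.ext h)
  · simp

theorem jordanWigner_anticommute {n k l : ℕ} (hkl : k ≠ l) (hk : k < 2 * n) (hl : l < 2 * n) :
    jordanWigner n k * jordanWigner n l = -(jordanWigner n l * jordanWigner n k) := by
  rcases hkl.lt_or_gt with h | h
  · exact jordanWigner_mul_of_lt h hk
  · rw [jordanWigner_mul_of_lt h hl, neg_neg]

/-! ### Signs indexed by `ZMod 2` -/

/-- The sign `(-1)^a` for `a : ZMod 2`. -/
def sgn (a : ZMod 2) : ℂ := (-1) ^ a.val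

@[simp] theorem sgn_zero : sgn 0 = 1 := by simp [sgn]

@[simp] theorem sgn_one : sgn 1 = -1 := by simp [sgn, ZMod.val_one]

theorem zmod_two_cases (a : ZMod 2) : a = 0 ∨ a = 1 := by revert a; decide

theorem sgn_add (a b : ZMod 2) : sgn (a + b) = sgn a * sgn b := by
  have h : (1 + 1 : ZMod 2) = 0 := by decide
  rcases zmod_two_cases a with rfl | rfl <;> rcases zmod_two_cases b with rfl | rfl <;> simp [h]

theorem sgn_mul_self (a : ZMod 2) : sgn a * sgn a = 1 := by
  rcases zmod_two_cases a with rfl | rfl <;> simp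

theorem sgn_natCast (k : ℕ) : sgn (k : ZMod 2) = (-1) ^ k := by
  induction k with
  | zero => simp
  | succ k ih => rw [Nat.cast_succ, sgn_add, ih, pow_succ, sgn_one]

/-! ### Ordered products of elements that commute up to sign -/

section Lists

variable {ι R : Type*}

theorem prod_map_ite_one [Monoid R] (p : ι → Prop) [DecidablePred p] (g : ι → R) (l : List ι) :
    (l.map fun i => if p i then g i else 1).prod = ((l.filter fun i => p i).map g).prod := by
  induction l with
  | nil => rfl
  | cons a l ih => by_cases h : p a <;> simp [h, ih]

theorem prod_map_mul_prod_map_reverse [Monoid R] (g : ι → R) (l : List ι)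
    (h : ∀ i ∈ l, g i * g i = 1) : (l.map g).prod * (l.reverse.map g).prod = 1 := by
  induction l with
  | nil => simp
  | cons a l ih =>
    have ih' := ih fun i hi => h i (List.mem_cons_of_mem _ hi)
    rw [List.reverse_cons, List.map_append, List.prod_append, List.map_singleton,
      List.prod_singleton, List.map_cons, List.prod_cons, mul_assoc, ← mul_assoc (l.map g).prod,
      ih', one_mul, h a List.mem_cons_self]

variable [Ring R] [Algebra ℂ R]

theorem prod_map_mul_of_commute_sgn (g : ι → R) (T : R) (e : ι → ZMod 2) (l : List ι)
    (h : ∀ i ∈ l, g i * T = sgn (e i) • (T * g i)) :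
    (l.map g).prod * T = sgn (l.map e).sum • (T * (l.map g).prod) := by
  induction l with
  | nil => simp
  | cons a l ih =>
    have ih' := ih fun i hi => h i (List.mem_cons_of_mem _ hi)
    simp only [List.map_cons, List.prod_cons, List.sum_cons, sgn_add]
    rw [mul_assoc, ih', mul_smul_comm, ← mul_assoc, h a List.mem_cons_self, smul_mul_assoc,
      smul_smul, mul_assoc, mul_comm (sgn _) (sgn (e a))]

/-- Reversing a list of length ℓ exchanges each of its ℓ(ℓ−1)/2 pairs once. In the adjoint of a
Clifford product this sign cancels against the conjugated phase. -/
theorem prod_map_reverse_of_anticommute (g : ι → R) (l : List ι) (hl : l.Nodup)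
    (h : ∀ i ∈ l, ∀ j ∈ l, i ≠ j → g i * g j = -(g j * g i)) :
    (l.reverse.map g).prod = (-1 : ℂ) ^ (l.length.choose 2) • (l.map g).prod := by
  induction l with
  | nil => simp
  | cons a l ih =>
    rw [List.nodup_cons] at hl
    have ih' := ih hl.2 fun i hi j hj =>
      h i (List.mem_cons_of_mem _ hi) j (List.mem_cons_of_mem _ hj)
    have hc : (l.map g).prod * g a = sgn (l.map fun _ => (1 : ZMod 2)).sum •
        (g a * (l.map g).prod) := by
      refine prod_map_mul_of_commute_sgn g (g a) (fun _ => 1) l fun i hi => ?_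
      rw [h i (List.mem_cons_of_mem _ hi) a List.mem_cons_self (by rintro rfl; exact hl.1 hi)]
      simp
    rw [List.reverse_cons, List.map_append, List.prod_append, ih', List.map_singleton,
      List.prod_singleton, smul_mul_assoc, hc, List.map_const', List.sum_replicate, nsmul_one,
      sgn_natCast, smul_smul, List.map_cons, List.prod_cons, List.length_cons,
      Nat.choose_succ_succ' l.length 1, Nat.choose_one_right, pow_add, mul_comm]

end Lists

/-! ### Clifford products -/

/-- The elements of `A` in increasing order. -/
def orderedList {N : ℕ} (A : Finset (Fin N)) : List (Fin N) :=
  (List.finRange N).filter (· ∈ A)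

theorem nodup_orderedList {N : ℕ} (A : Finset (Fin N)) : (orderedList A).Nodup :=
  (List.nodup_finRange N).filter _

theorem toFinset_orderedList {N : ℕ} (A : Finset (Fin N)) : (orderedList A).toFinset = A := by
  ext x; simp [orderedList]

theorem length_orderedList {N : ℕ} (A : Finset (Fin N)) : (orderedList A).length = A.card := by
  rw [← List.toFinset_card_of_nodup (nodup_orderedList A), toFinset_orderedList]

theorem sum_map_orderedList {N : ℕ} (A : Finset (Fin N)) (e : Fin N → ZMod 2) :
    ((orderedList A).map e).sum = ∑ i ∈ A, e i := by
  rw [← List.sum_toFinset e (nodup_orderedList A), toFinset_orderedList]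

theorem Γ_of_lt {n k : ℕ} (hk : k < 2 * n) : Γ n k = jordanWigner n k := if_pos hk

theorem cliffordProduct_eq (n : ℕ) (A : Finset (Fin (2 * n))) :
    cliffordProduct n A =
      Complex.I ^ (A.card.choose 2) • ((orderedList A).map fun k : Fin (2 * n) => Γ n k).prod := by
  rw [cliffordProduct, List.ofFn_eq_map, prod_map_ite_one]
  rfl

theorem conjTranspose_list_prod {m : Type*} [Fintype m] [DecidableEq m]
    {ι : Type*} (g : ι → Matrix m m ℂ) (l : List ι) (h : ∀ i ∈ l, (g i)ᴴ = g i) :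
    ((l.map g).prod)ᴴ = (l.reverse.map g).prod := by
  rw [Matrix.conjTranspose_list_prod, List.map_map, List.map_reverse]
  congr 2
  exact List.map_congr_left h

theorem star_I_pow (c : ℕ) : star (Complex.I ^ c) = (-1) ^ c * Complex.I ^ c := by
  rw [star_pow, ← mul_pow]; simp

theorem conjTranspose_cliffordProduct {n : ℕ} (A : Finset (Fin (2 * n))) :
    (cliffordProduct n A)ᴴ = cliffordProduct n A := by
  rw [cliffordProduct_eq, Matrix.conjTranspose_smul, conjTranspose_list_prod,
    prod_map_reverse_of_anticommute _ _ (nodup_orderedList A), length_orderedList, star_I_pow,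
    smul_smul, mul_right_comm, ← mul_pow]
  · simp
  · intro i _ j _ hij
    simp only [Γ_of_lt i.2, Γ_of_lt j.2]
    exact jordanWigner_anticommute (fun h => hij (Fin.ext h)) i.2 j.2
  · intro i _
    simp only [Γ_of_lt i.2, conjTranspose_jordanWigner]

theorem cliffordProduct_mul_self {n : ℕ} (A : Finset (Fin (2 * n))) :
    cliffordProduct n A * cliffordProduct n A = 1 := by
  nth_rw 2 [← conjTranspose_cliffordProduct]
  rw [cliffordProduct_eq, Matrix.conjTranspose_smul, conjTranspose_list_prod, smul_mul_smul_comm,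
    prod_map_mul_prod_map_reverse, star_I_pow, mul_left_comm, ← mul_pow, ← mul_pow]
  · simp
  · intro i _
    simp only [Γ_of_lt i.2, jordanWigner_mul_self]
  · intro i _
    simp only [Γ_of_lt i.2, conjTranspose_jordanWigner]

/-- The indicator function of `A ⊆ {0, …, 2n-1}` on `{0, …, 2n}`. -/
def ind {n : ℕ} (A : Finset (Fin (2 * n))) (x : Fin (2 * n + 1)) : ZMod 2 :=
  if x ∈ A.map Fin.castSuccEmb then 1 else 0

theorem ind_castSucc {n : ℕ} (A : Finset (Fin (2 * n))) (k : Fin (2 * n)) :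
    ind A k.castSucc = if k ∈ A then 1 else 0 := by
  simp [ind]

theorem ind_last {n : ℕ} (A : Finset (Fin (2 * n))) : ind A (Fin.last (2 * n)) = 0 := by
  simp [ind, Fin.castSucc_ne_last]

theorem sum_ind {n : ℕ} (A : Finset (Fin (2 * n))) : ∑ x, ind A x = A.card := by
  rw [Fin.sum_univ_castSucc, ind_last, add_zero]
  simp [ind_castSucc]

theorem ind_injective {n : ℕ} : Function.Injective (ind (n := n)) := by
  intro A B h
  ext k
  have := congrFun h k.castSucc
  rw [ind_castSucc, ind_castSucc] at this
  by_cases hA : k ∈ A <;> by_cases hB : k ∈ B <;> simp_all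

theorem exists_ind_eq {n : ℕ} (f : Fin (2 * n + 1) → ZMod 2) (hf : f (Fin.last _) = 0) :
    ∃ A, ind A = f := by
  refine ⟨Finset.univ.filter fun k => f k.castSucc = 1, ?_⟩
  ext x
  refine Fin.lastCases ?_ (fun k => ?_) x
  · rw [ind_last, hf]
  · rw [ind_castSucc]
    rcases zmod_two_cases (f k.castSucc) with h | h <;> simp [h]

theorem cliffordProduct_mul_Γ_castSucc {n : ℕ} (A : Finset (Fin (2 * n))) (k : Fin (2 * n)) :
    cliffordProduct n A * Γ n k =
      sgn (A.card + ind A k.castSucc) • (Γ n k * cliffordProduct n A) := by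
  rw [cliffordProduct_eq, smul_mul_assoc, mul_smul_comm,
    prod_map_mul_of_commute_sgn _ _ (fun i => 1 + if i = k then 1 else 0), smul_comm,
    sum_map_orderedList, Finset.sum_add_distrib, ind_castSucc]
  · simp
  · intro i _
    by_cases h : i = k
    · subst h
      have : (1 + 1 : ZMod 2) = 0 := by decide
      simp [this]
    · simp only [Γ_of_lt i.2, Γ_of_lt k.2, h, if_false, add_zero, sgn_one, neg_smul, one_smul]
      exact jordanWigner_anticommute (fun h' => h (Fin.ext h')) i.2 k.2

theorem cliffordProduct_univ (n : ℕ) : cliffordProduct n Finset.univ = Γ n (2 * n) := by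
  -- The phases agree because n(2n−1) − n = 2n(n−1) is divisible by 4.
  have h : (2 * n).choose 2 % 4 = n % 4 := by
    rw [Nat.choose_two_right, mul_assoc, Nat.mul_div_cancel_left _ (by norm_num)]
    obtain ⟨q, rfl | rfl | rfl | rfl⟩ :
        ∃ q, n = 4 * q ∨ n = 4 * q + 1 ∨ n = 4 * q + 2 ∨ n = 4 * q + 3 := ⟨n / 4, by omega⟩
    · rw [mul_assoc]; simp
    · rw [show 2 * (4 * q + 1) - 1 = 8 * q + 1 by omega]; ring_nf; omega
    · rw [show 2 * (4 * q + 2) - 1 = 8 * q + 3 by omega]; ring_nf; omega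
    · rw [show 2 * (4 * q + 3) - 1 = 8 * q + 5 by omega]; ring_nf; omega
  have hI : Complex.I ^ ((2 * n).choose 2) = Complex.I ^ n := by
    rw [pow_eq_pow_mod _ Complex.I_pow_four, h, ← pow_eq_pow_mod _ Complex.I_pow_four]
  rw [cliffordProduct, Γ, if_neg (lt_irrefl _), Finset.card_univ, Fintype.card_fin, hI]
  congr 3
  ext1 k
  rw [if_pos (Finset.mem_univ k), Γ_of_lt k.2]

theorem conjTranspose_Γ {n : ℕ} (x : Fin (2 * n + 1)) : (Γ n x)ᴴ = Γ n x := by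
  refine Fin.lastCases ?_ (fun k => ?_) x
  · rw [Fin.val_last, ← cliffordProduct_univ, conjTranspose_cliffordProduct]
  · rw [Fin.val_castSucc, Γ_of_lt k.2, conjTranspose_jordanWigner]

theorem Γ_mul_self {n : ℕ} (x : Fin (2 * n + 1)) : Γ n x * Γ n x = 1 := by
  refine Fin.lastCases ?_ (fun k => ?_) x
  · rw [Fin.val_last, ← cliffordProduct_univ, cliffordProduct_mul_self]
  · rw [Fin.val_castSucc, Γ_of_lt k.2, jordanWigner_mul_self]

theorem Γ_last_mul {n : ℕ} (k : Fin (2 * n)) : Γ n (2 * n) * Γ n k = -(Γ n k * Γ n (2 * n)) := by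
  rw [← cliffordProduct_univ, cliffordProduct_mul_Γ_castSucc, ind_castSucc]
  have : (((2 * n : ℕ) : ZMod 2)) = 0 := (ZMod.natCast_eq_zero_iff _ _).2 ⟨n, rfl⟩
  simp only [Finset.card_univ, Fintype.card_fin, this, Finset.mem_univ, if_true, zero_add, sgn_one,
    neg_smul, one_smul]

theorem Γ_anticommute {n : ℕ} {x y : Fin (2 * n + 1)} (hxy : x ≠ y) :
    Γ n x * Γ n y = -(Γ n y * Γ n x) := by
  induction x using Fin.lastCases with
  | last =>
    induction y using Fin.lastCases with
    | last => exact absurd rfl hxy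
    | cast l => simpa using Γ_last_mul l
  | cast k =>
    induction y using Fin.lastCases with
    | last => rw [Fin.val_last, Fin.val_castSucc, Γ_last_mul k, neg_neg]
    | cast l =>
      simp only [Fin.val_castSucc, Γ_of_lt k.2, Γ_of_lt l.2]
      exact jordanWigner_anticommute (fun h => hxy (by rw [Fin.ext h])) k.2 l.2

theorem cliffordProduct_mul_Γ {n : ℕ} (A : Finset (Fin (2 * n))) (x : Fin (2 * n + 1)) :
    cliffordProduct n A * Γ n x = sgn (A.card + ind A x) • (Γ n x * cliffordProduct n A) := by
  induction x using Fin.lastCases with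
  | cast k => exact cliffordProduct_mul_Γ_castSucc A k
  | last =>
    rw [cliffordProduct_eq, smul_mul_assoc, mul_smul_comm,
      prod_map_mul_of_commute_sgn _ _ (fun _ => 1), smul_comm, sum_map_orderedList, ind_last]
    · simp
    · intro i _
      rw [Fin.val_last, Γ_last_mul i]
      simp

theorem cliffordProduct_mul_cliffordProduct {n : ℕ} (A B : Finset (Fin (2 * n))) :
    cliffordProduct n A * cliffordProduct n B =
      sgn (A.card * B.card + ∑ x, ind A x * ind B x) •
        (cliffordProduct n B * cliffordProduct n A) := by
  have h := prod_map_mul_of_commute_sgn (fun k : Fin (2 * n) => Γ n k) (cliffordProduct n A)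
    (fun k => A.card + ind A k.castSucc) (orderedList B) (fun i _ => by
      rw [show Γ n (i : ℕ) = Γ n (i.castSucc : ℕ) from rfl, cliffordProduct_mul_Γ, smul_smul,
        sgn_mul_self, one_smul])
  have hs : (∑ x, ind A x * ind B x) = ∑ k ∈ B, ind A k.castSucc := by
    rw [Fin.sum_univ_castSucc, ind_last, zero_mul, add_zero]
    simp [ind_castSucc, Finset.inter_comm]
  have hs' : ((A.card : ZMod 2) * B.card + ∑ x, ind A x * ind B x) =
      ((orderedList B).map fun k => (A.card : ZMod 2) + ind A k.castSucc).sum := by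
    rw [sum_map_orderedList, Finset.sum_add_distrib, hs, Finset.sum_const, nsmul_eq_mul, mul_comm]
  rw [hs', cliffordProduct_eq n B, mul_smul_comm, smul_mul_assoc, h, smul_smul, smul_smul,
    mul_right_comm, sgn_mul_self, one_mul]

theorem cliffordProduct_empty (n : ℕ) : cliffordProduct n ∅ = 1 := by
  simp [cliffordProduct_eq, orderedList]

theorem cliffordProduct_singleton {n : ℕ} (k : Fin (2 * n)) : cliffordProduct n {k} = Γ n k := by
  rw [cliffordProduct_eq]
  have : orderedList {k} = [k] := by
    rw [← List.perm_singleton]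
    refine (List.perm_ext_iff_of_nodup (nodup_orderedList _) (List.nodup_singleton k)).2 fun x => ?_
    simp [orderedList]
  simp [this]

/-! ### Trace orthogonality -/

theorem trace_eq_zero_of_anticommute {m : Type*} [Fintype m] [DecidableEq m]
    {T G : Matrix m m ℂ} (hG : G * G = 1) (h : T * G = -(G * T)) : T.trace = 0 := by
  have h1 : T.trace = (G * (T * G)).trace := by
    rw [Matrix.trace_mul_comm, mul_assoc, hG, mul_one]
  have h2 : (G * (T * G)).trace = -T.trace := by
    rw [h, mul_neg, ← mul_assoc, hG, one_mul, Matrix.trace_neg]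
  rw [h2] at h1
  exact self_eq_neg.mp h1

/-- Some generator anticommutes with Γ_A Γ_B. Otherwise A and B have the same sign pattern;
comparing at the index 2n, which neither contains, gives equal parities and then A = B. -/
theorem trace_cliffordProduct_mul {n : ℕ} {A B : Finset (Fin (2 * n))} (hAB : A ≠ B) :
    (cliffordProduct n A * cliffordProduct n B).trace = 0 := by
  obtain ⟨x, hx⟩ : ∃ x, (A.card + ind A x : ZMod 2) + (B.card + ind B x) = 1 := by
    by_contra! hne
    have h0 : ∀ x, (A.card + ind A x : ZMod 2) + (B.card + ind B x) = 0 := fun x =>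
      (zmod_two_cases _).resolve_right (hne x)
    have hl := h0 (Fin.last _)
    simp only [ind_last, add_zero] at hl
    refine hAB (ind_injective (funext fun x => ?_))
    have hx := h0 x
    have : ind A x + ind B x = 0 := by linear_combination hx - hl
    exact CharTwo.add_eq_zero.mp this
  refine trace_eq_zero_of_anticommute (Γ_mul_self x) ?_
  rw [mul_assoc, cliffordProduct_mul_Γ, mul_smul_comm, ← mul_assoc, cliffordProduct_mul_Γ,
    smul_mul_assoc, smul_smul, ← sgn_add, add_comm, hx, sgn_one, neg_smul, one_smul, mul_assoc]

theorem trace_cliffordProduct_mul_eq {n : ℕ} (A B : Finset (Fin (2 * n))) :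
    (cliffordProduct n A * cliffordProduct n B).trace = if A = B then (2 : ℂ) ^ n else 0 := by
  split_ifs with h
  · rw [h, cliffordProduct_mul_self, Matrix.trace_one]
    simp
  · exact trace_cliffordProduct_mul h

theorem cliffordProduct_injective (n : ℕ) : Function.Injective (cliffordProduct n) := by
  intro A B h
  by_contra hne
  have h1 := trace_cliffordProduct_mul_eq A B
  rw [h, cliffordProduct_mul_self, if_neg hne, Matrix.trace_one] at h1
  simp at h1

/-! ### The commutant of the generators -/

theorem linearIndependent_cliffordProduct (n : ℕ) : LinearIndependent ℂ (cliffordProduct n) := by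
  rw [Fintype.linearIndependent_iff]
  intro g hg B
  have h := congrArg (fun T => (T * cliffordProduct n B).trace) hg
  simp only [Finset.sum_mul, Matrix.trace_sum, smul_mul_assoc, Matrix.trace_smul,
    trace_cliffordProduct_mul_eq, zero_mul, Matrix.trace_zero] at h
  simpa using h

/-- There are 2^{2n} independent products, which is the dimension of the matrix space. -/
theorem span_cliffordProduct (n : ℕ) : Submodule.span ℂ (Set.range (cliffordProduct n)) = ⊤ := by
  refine (linearIndependent_cliffordProduct n).span_eq_top_of_card_eq_finrank' ?_
  rw [Module.finrank_matrix]
  simp [← pow_add, two_mul]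

theorem commute_cliffordProduct {n : ℕ} {T : Op n} (h : ∀ x : Fin (2 * n + 1), Commute T (Γ n x))
    (A : Finset (Fin (2 * n))) : Commute T (cliffordProduct n A) := by
  rw [cliffordProduct_eq]
  refine Commute.smul_right (Commute.list_prod_right _ _ fun x hx => ?_) _
  obtain ⟨k, _, rfl⟩ := List.mem_map.1 hx
  exact h k.castSucc

/-- A matrix that commutes with all the generators is scalar. -/
theorem exists_eq_smul_one_of_commute {n : ℕ} {T : Op n}
    (h : ∀ x : Fin (2 * n + 1), Commute T (Γ n x)) : ∃ c : ℂ, T = c • 1 := by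
  have hall : ∀ M : Op n, Commute T M := fun M => by
    have hM : M ∈ Submodule.span ℂ (Set.range (cliffordProduct n)) := by
      rw [span_cliffordProduct]; trivial
    induction hM using Submodule.span_induction with
    | mem x hx =>
      obtain ⟨A, rfl⟩ := hx
      exact commute_cliffordProduct h A
    | zero => exact Commute.zero_right T
    | add x y _ _ hx hy => exact hx.add_right hy
    | smul a x _ hx => exact hx.smul_right a
  obtain ⟨c, hc⟩ := mem_range_scalar_iff_commute_single'.2 fun i j => (hall (single i j 1)).symm
  exact ⟨c, by rw [← hc, Matrix.smul_one_eq_diagonal]; rfl⟩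

/-! ### Unitaries implementing permutations of the generators -/

/-- The unitary `V` permutes the generators `Γ_0, …, Γ_{2n}` by conjugation according to `π`. -/
structure Implements {n : ℕ} (V : Op n) (π : Equiv.Perm (Fin (2 * n + 1))) : Prop where
  conjTranspose_mul_self : Vᴴ * V = 1
  mul_conjTranspose_self : V * Vᴴ = 1
  mul_Γ : ∀ x : Fin (2 * n + 1), V * Γ n x = Γ n (π x) * V

namespace Implements

variable {n : ℕ} {V V' : Op n} {π π' : Equiv.Perm (Fin (2 * n + 1))}

theorem one : Implements (1 : Op n) 1 where
  conjTranspose_mul_self := by simp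
  mul_conjTranspose_self := by simp
  mul_Γ := by simp

theorem mul (h : Implements V π) (h' : Implements V' π') : Implements (V * V') (π * π') where
  conjTranspose_mul_self := by
    rw [conjTranspose_mul, mul_assoc, ← mul_assoc Vᴴ, h.1, one_mul, h'.1]
  mul_conjTranspose_self := by
    rw [conjTranspose_mul, mul_assoc, ← mul_assoc V', h'.2, one_mul, h.2]
  mul_Γ x := by
    rw [mul_assoc, h'.3, ← mul_assoc, h.3, mul_assoc, Equiv.Perm.mul_apply]

theorem pow (h : Implements V π) (k : ℕ) : Implements (V ^ k) (π ^ k) := by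
  induction k with
  | zero => exact one
  | succ k ih => rw [pow_succ, pow_succ]; exact ih.mul h

theorem conjTranspose (h : Implements V π) : Implements Vᴴ π⁻¹ where
  conjTranspose_mul_self := by rw [conjTranspose_conjTranspose, h.2]
  mul_conjTranspose_self := by rw [conjTranspose_conjTranspose, h.1]
  mul_Γ x := by
    have hx := h.3 (π⁻¹ x)
    rw [show π (π⁻¹ x) = x from π.apply_symm_apply x] at hx
    calc Vᴴ * Γ n x = Vᴴ * (Γ n x * V) * Vᴴ := by rw [mul_assoc, mul_assoc, h.2, mul_one]
      _ = Γ n (π⁻¹ x) * Vᴴ := by rw [← hx, ← mul_assoc, h.1, one_mul]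

theorem smul (h : Implements V π) {c : ℂ} (hc : star c * c = 1) : Implements (c • V) π where
  conjTranspose_mul_self := by
    rw [conjTranspose_smul, smul_mul_smul_comm, hc, one_smul, h.1]
  mul_conjTranspose_self := by
    rw [conjTranspose_smul, smul_mul_smul_comm, mul_comm, hc, one_smul, h.2]
  mul_Γ x := by rw [smul_mul_assoc, h.3, mul_smul_comm]

theorem conj_Γ (h : Implements V π) (x : Fin (2 * n + 1)) : V * Γ n x * Vᴴ = Γ n (π x) := by
  rw [h.3, mul_assoc, h.2, mul_one]

theorem conj_mul_self (h : Implements V π) {T : Op n} (hT : T * T = 1) :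
    (V * T * Vᴴ) * (V * T * Vᴴ) = 1 := by
  calc (V * T * Vᴴ) * (V * T * Vᴴ) = V * T * (Vᴴ * V) * (T * Vᴴ) := by simp only [mul_assoc]
    _ = V * (T * T) * Vᴴ := by rw [h.1, mul_one]; simp only [mul_assoc]
    _ = 1 := by rw [hT, mul_one, h.2]

/-- Conjugation by a unitary that permutes the generators permutes the Clifford products up to
sign. -/
theorem conj_cliffordProduct (h : Implements V π) {A B : Finset (Fin (2 * n))}
    (hAB : ∀ x, (A.card + ind A x : ZMod 2) = B.card + ind B (π x)) :
    V * cliffordProduct n A * Vᴴ = cliffordProduct n B ∨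
      V * cliffordProduct n A * Vᴴ = -cliffordProduct n B := by
  set T := V * cliffordProduct n A * Vᴴ with hT
  -- The conjugate T and Γ_B have the same signs against every generator, so T Γ_B is a scalar c; T²
  -- = 1 then forces c = ±1.
  have hTΓ : ∀ x, T * Γ n (π x) = sgn (A.card + ind A x) • (Γ n (π x) * T) := fun x => by
    have hx : Vᴴ * Γ n (π x) = Γ n x * Vᴴ := by
      simpa using h.conjTranspose.3 (π x)
    rw [hT, mul_assoc, hx, ← mul_assoc, mul_assoc V, cliffordProduct_mul_Γ, mul_smul_comm,
      smul_mul_assoc, ← mul_assoc V, h.3]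
    simp only [mul_assoc]
  have hc : ∀ x : Fin (2 * n + 1), Commute (T * cliffordProduct n B) (Γ n x) := fun x => by
    obtain ⟨y, rfl⟩ := π.surjective x
    change _ * _ = _ * _
    rw [mul_assoc, cliffordProduct_mul_Γ, mul_smul_comm, ← mul_assoc, hTΓ, smul_mul_assoc,
      smul_smul, ← hAB, sgn_mul_self, one_smul, mul_assoc]
  obtain ⟨c, hc⟩ := exists_eq_smul_one_of_commute hc
  have hTc : T = c • cliffordProduct n B := by
    rw [← mul_one T, ← cliffordProduct_mul_self B, ← mul_assoc, hc, smul_mul_assoc, one_mul]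
  have h1 : T * T = 1 := h.conj_mul_self (cliffordProduct_mul_self A)
  rw [hTc, smul_mul_smul_comm, cliffordProduct_mul_self] at h1
  have h2 : c * c = 1 := by
    have := congrFun (congrFun h1 0) 0
    simpa using this
  rcases mul_self_eq_one_iff.1 h2 with rfl | rfl
  · left; simpa using hTc
  · right; simpa using hTc

end Implements

/-- The reflection `(Γ_i - Γ_j) / √2`, which exchanges `Γ_i` and `Γ_j` up to sign. -/
noncomputable def reflection (n : ℕ) (i j : Fin (2 * n + 1)) : Op n :=
  ((Real.sqrt 2 : ℝ) : ℂ)⁻¹ • (Γ n i - Γ n j)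

theorem conjTranspose_reflection {n : ℕ} (i j : Fin (2 * n + 1)) :
    (reflection n i j)ᴴ = reflection n i j := by
  rw [reflection, conjTranspose_smul, conjTranspose_sub, conjTranspose_Γ, conjTranspose_Γ]
  simp

theorem reflection_mul_self {n : ℕ} {i j : Fin (2 * n + 1)} (hij : i ≠ j) :
    reflection n i j * reflection n i j = 1 := by
  have h2 : ((Real.sqrt 2 : ℝ) : ℂ)⁻¹ * ((Real.sqrt 2 : ℝ) : ℂ)⁻¹ = 2⁻¹ := by
    rw [← mul_inv, ← Complex.ofReal_mul, Real.mul_self_sqrt (by norm_num)]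
    norm_num
  rw [reflection, smul_mul_smul_comm, h2, sub_mul, mul_sub, mul_sub, Γ_mul_self, Γ_mul_self,
    Γ_anticommute hij, show (1 : Op n) - -(Γ n j * Γ n i) - (Γ n j * Γ n i - 1) = (2 : ℂ) • 1 by
      rw [two_smul]; abel, smul_smul]
  norm_num

theorem reflection_mul_Γ {n : ℕ} {i j : Fin (2 * n + 1)} (hij : i ≠ j) (x : Fin (2 * n + 1)) :
    reflection n i j * Γ n x = -(Γ n (Equiv.swap i j x) * reflection n i j) := by
  rw [reflection, smul_mul_assoc, mul_smul_comm, ← smul_neg]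
  congr 1
  by_cases hi : x = i
  · subst hi
    rw [Equiv.swap_apply_left, sub_mul, mul_sub, Γ_mul_self, Γ_mul_self]
    abel
  by_cases hj : x = j
  · subst hj
    rw [Equiv.swap_apply_right, sub_mul, mul_sub, Γ_mul_self, Γ_mul_self]
    abel
  rw [Equiv.swap_apply_of_ne_of_ne hi hj, sub_mul, mul_sub, Γ_anticommute hi, Γ_anticommute hj]
  abel

/-- The sign cannot be avoided: conjugation fixes the scalar Γ_0 ⋯ Γ_{2n}, while permuting its
factors multiplies it by the sign of π. -/
theorem exists_unitary_mul_Γ {n : ℕ} (π : Equiv.Perm (Fin (2 * n + 1))) :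
    ∃ V : Op n, Vᴴ * V = 1 ∧ V * Vᴴ = 1 ∧
      ∀ x : Fin (2 * n + 1), V * Γ n x = ((Equiv.Perm.sign π : ℤ) : ℂ) • (Γ n (π x) * V) := by
  induction π using Equiv.Perm.swap_induction_on with
  | one => exact ⟨1, by simp⟩
  | swap_mul f i j hij ih =>
    obtain ⟨V, h1, h2, h3⟩ := ih
    refine ⟨reflection n i j * V, ?_, ?_, fun x => ?_⟩
    · rw [conjTranspose_mul, conjTranspose_reflection, mul_assoc, ← mul_assoc (reflection n i j),
        reflection_mul_self hij, one_mul, h1]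
    · rw [conjTranspose_mul, conjTranspose_reflection, mul_assoc, ← mul_assoc V, h2, one_mul,
        reflection_mul_self hij]
    · rw [mul_assoc, h3, mul_smul_comm, ← mul_assoc, reflection_mul_Γ hij, Equiv.Perm.sign_mul,
        Equiv.Perm.sign_swap hij, Equiv.Perm.mul_apply]
      simp [mul_assoc]

/-- An even permutation of the generators of order dividing `L` is implemented by a unitary of
order dividing `L`. -/
theorem exists_implements_pow_eq_one {n L : ℕ} (hL : 0 < L) {σ : Equiv.Perm (Fin (2 * n + 1))}
    (hσ : Equiv.Perm.sign σ = 1) (hσL : σ ^ L = 1) :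
    ∃ U : Op n, Implements U σ ∧ U ^ L = 1 := by
  obtain ⟨V, h1, h2, h3⟩ := exists_unitary_mul_Γ σ
  have hV : Implements V σ := ⟨h1, h2, fun x => by simpa [hσ] using h3 x⟩
  have hVL := hV.pow L
  obtain ⟨c, hc⟩ : ∃ c : ℂ, V ^ L = c • 1 := exists_eq_smul_one_of_commute fun x => by
    have := hVL.3 x
    rwa [hσL, Equiv.Perm.one_apply] at this
  have hcc : star c * c = 1 := by
    have h := hVL.1
    rw [hc, conjTranspose_smul, smul_mul_smul_comm, conjTranspose_one, mul_one] at h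
    have := congrFun (congrFun h 0) 0
    simpa using this
  -- The correcting phase is an L-th root of c⁻¹; it has modulus 1 because c does, so unitarity
  -- survives.
  obtain ⟨z, hz⟩ := IsAlgClosed.exists_pow_nat_eq c⁻¹ hL
  have hc1 : ‖c‖ = 1 := by
    have := congrArg norm hcc
    rw [norm_mul, norm_star, norm_one] at this
    nlinarith [norm_nonneg c]
  have hz1 : ‖z‖ = 1 := by
    have := congrArg norm hz
    rw [norm_pow, norm_inv, hc1, inv_one] at this
    exact (pow_eq_one_iff_of_nonneg (norm_nonneg z) hL.ne').1 this
  refine ⟨z • V, hV.smul ?_, ?_⟩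
  · rw [Complex.star_def, Complex.conj_mul', hz1]; simp
  · rw [smul_pow, hz, hc, smul_smul, inv_mul_cancel₀, one_smul]
    rintro rfl
    simp at hc1

/-! ### Joint eigenvectors of maximal families of Clifford products -/

theorem trace_sum_mul_sum {n : ℕ} (S T : Finset (Finset (Fin (2 * n))))
    (μ ν : Finset (Fin (2 * n)) → ℂ) :
    ((∑ A ∈ S, μ A • cliffordProduct n A) * (∑ B ∈ T, ν B • cliffordProduct n B)).trace =
      2 ^ n * ∑ A ∈ S ∩ T, μ A * ν A := by
  simp only [Finset.sum_mul, Finset.mul_sum, Matrix.trace_sum, smul_mul_smul_comm,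
    Matrix.trace_smul, trace_cliffordProduct_mul_eq, smul_eq_mul, mul_ite, mul_zero]
  simp only [Finset.sum_ite_eq', Finset.sum_ite_mem]
  rw [Finset.inter_comm]
  exact Finset.sum_congr rfl fun A _ => mul_comm _ _

/-- The rank-one matrix `|v⟩⟨v|`. -/
def rankOne {m : Type*} (v : m → ℂ) : Matrix m m ℂ := vecMulVec v (star v)

theorem trace_rankOne_mul_rankOne {m : Type*} [Fintype m] (v w : m → ℂ) :
    (rankOne v * rankOne w).trace = (star v ⬝ᵥ w) * star (star v ⬝ᵥ w) := by
  rw [rankOne, rankOne, vecMulVec_mul_vecMulVec, Matrix.trace_vecMulVec]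
  simp [dotProduct_comm, ← star_dotProduct_star]

theorem eigenvalue_mul_self {n : ℕ} {A : Finset (Fin (2 * n))} {v : (Fin n → Fin 2) → ℂ}
    (hv : star v ⬝ᵥ v = 1) {μ : ℂ} (h : cliffordProduct n A *ᵥ v = μ • v) : μ * μ = 1 := by
  have h1 : v = (μ * μ) • v := by
    conv_lhs => rw [← one_mulVec v, ← cliffordProduct_mul_self A, ← mulVec_mulVec, h, mulVec_smul, h,
      smul_smul]
  have h2 := congrArg (fun w => star v ⬝ᵥ w) h1
  simpa [hv] using h2.symm

open scoped ComplexOrder in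
-- With ρ = |v⟩⟨v|, Q = ∑ μ_A Γ_A and d = 2^n, one has Qρ = dρ and tr Q² = d². Hence the squared
-- Hilbert–Schmidt norm of ρ − Q/d is 1 − 2 + 1 = 0.
theorem rankOne_eq_sum {n : ℕ} (S : Finset (Finset (Fin (2 * n)))) (hS : S.card = 2 ^ n)
    {v : (Fin n → Fin 2) → ℂ} (hv : star v ⬝ᵥ v = 1) {μ : Finset (Fin (2 * n)) → ℂ}
    (hμ : ∀ A ∈ S, cliffordProduct n A *ᵥ v = μ A • v) :
    rankOne v = ((2 : ℂ) ^ n)⁻¹ • ∑ A ∈ S, μ A • cliffordProduct n A := by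
  have hμ2 : ∀ A ∈ S, μ A * μ A = 1 := fun A hA => eigenvalue_mul_self hv (hμ A hA)
  have hstar : ∀ A ∈ S, star (μ A) = μ A := fun A hA => by
    rcases mul_self_eq_one_iff.1 (hμ2 A hA) with h | h <;> simp [h]
  have hd : ((2 : ℂ) ^ n) ≠ 0 := pow_ne_zero _ two_ne_zero
  set Q : Op n := ∑ A ∈ S, μ A • cliffordProduct n A with hQ
  have hQH : Qᴴ = Q := by
    rw [hQ, conjTranspose_sum]
    refine Finset.sum_congr rfl fun A hA => ?_
    rw [conjTranspose_smul, hstar A hA, conjTranspose_cliffordProduct]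
  have hρH : (rankOne v)ᴴ = rankOne v := by
    rw [rankOne, conjTranspose_vecMulVec, star_star]
  have hsum : ∑ A ∈ S, μ A * μ A = 2 ^ n := by
    rw [Finset.sum_congr rfl hμ2, Finset.sum_const, hS]; simp
  have hQρ : (Q * rankOne v).trace = 2 ^ n := by
    have : Q * rankOne v = (2 : ℂ) ^ n • rankOne v := by
      rw [← hsum, Finset.sum_smul, hQ, Finset.sum_mul]
      refine Finset.sum_congr rfl fun A hA => ?_
      rw [rankOne, smul_mul_assoc, mul_vecMulVec, hμ A hA, smul_vecMulVec, smul_smul]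
    rw [this, Matrix.trace_smul, rankOne, Matrix.trace_vecMulVec, dotProduct_comm, hv]
    simp
  have hρQ : (rankOne v * Q).trace = 2 ^ n := by rw [Matrix.trace_mul_comm, hQρ]
  have hQQ : (Q * Q).trace = 2 ^ n * 2 ^ n := by
    rw [hQ, trace_sum_mul_sum, Finset.inter_self, hsum]
  have hρρ : (rankOne v * rankOne v).trace = 1 := by
    rw [trace_rankOne_mul_rankOne, hv]; simp
  rw [← sub_eq_zero, ← Matrix.trace_mul_conjTranspose_self_eq_zero_iff, conjTranspose_sub,
    conjTranspose_smul, hQH, hρH, star_inv₀, star_pow]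
  simp only [star_ofNat, sub_mul, mul_sub, smul_mul_assoc, mul_smul_comm, Matrix.trace_sub,
    Matrix.trace_smul, hQρ, hρQ, hQQ, hρρ, smul_eq_mul]
  field_simp
  ring

/-- Joint eigenvectors of two maximal families of Clifford products which have only the identity in
common are unbiased. -/
theorem norm_inner_of_inter_eq {n : ℕ} {S T : Finset (Finset (Fin (2 * n)))}
    (hS : S.card = 2 ^ n) (hT : T.card = 2 ^ n) (hST : S ∩ T = {∅}) {v w : Qubits n}
    (hv : ‖v‖ = 1) (hw : ‖w‖ = 1)
    (hvS : ∀ A ∈ S, ∃ μ : ℂ, toEuclideanLin (cliffordProduct n A) v = μ • v)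
    (hwT : ∀ A ∈ T, ∃ μ : ℂ, toEuclideanLin (cliffordProduct n A) w = μ • w) :
    ‖inner ℂ v w‖ = 1 / Real.sqrt ((2 : ℝ) ^ n) := by
  have key : ∀ (S : Finset (Finset (Fin (2 * n)))) (hS : S.card = 2 ^ n) (hST : ∅ ∈ S)
      (v : Qubits n) (hv : ‖v‖ = 1)
      (hvS : ∀ A ∈ S, ∃ μ : ℂ, toEuclideanLin (cliffordProduct n A) v = μ • v),
      ∃ μ : Finset (Fin (2 * n)) → ℂ, μ ∅ = 1 ∧
        rankOne (WithLp.ofLp v) = ((2 : ℂ) ^ n)⁻¹ • ∑ A ∈ S, μ A • cliffordProduct n A := by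
    intro S hS h0 v hv hvS
    have hv1 : star (WithLp.ofLp v) ⬝ᵥ WithLp.ofLp v = 1 := by
      rw [dotProduct_comm, ← EuclideanSpace.inner_eq_star_dotProduct, inner_self_eq_norm_sq_to_K, hv]
      simp
    choose! μ hμ using hvS
    have hμ' : ∀ A ∈ S, cliffordProduct n A *ᵥ WithLp.ofLp v = μ A • WithLp.ofLp v := fun A hA => by
      have := congrArg WithLp.ofLp (hμ A hA)
      simpa using this
    refine ⟨μ, ?_, rankOne_eq_sum S hS hv1 hμ'⟩
    have h := congrArg (fun u => star (WithLp.ofLp v) ⬝ᵥ u) (hμ' ∅ h0)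
    simpa [cliffordProduct_empty, hv1] using h.symm
  obtain ⟨h0S, h0T⟩ := Finset.mem_inter.1 (hST ▸ Finset.mem_singleton_self ∅ : ∅ ∈ S ∩ T)
  obtain ⟨μ, hμ0, hμ⟩ := key S hS h0S v hv hvS
  obtain ⟨ν, hν0, hν⟩ := key T hT h0T w hw hwT
  have h := trace_rankOne_mul_rankOne (WithLp.ofLp v) (WithLp.ofLp w)
  rw [hμ, hν, smul_mul_smul_comm, Matrix.trace_smul, trace_sum_mul_sum, hST, Finset.sum_singleton,
    hμ0, hν0, dotProduct_comm, ← EuclideanSpace.inner_eq_star_dotProduct, Complex.star_def,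
    Complex.mul_conj'] at h
  have hd : ((2 : ℂ) ^ n) ≠ 0 := pow_ne_zero _ two_ne_zero
  have h2 : ((‖inner ℂ v w‖ ^ 2 : ℝ) : ℂ) = (((2 : ℝ) ^ n)⁻¹ : ℝ) := by
    push_cast
    rw [← h, smul_eq_mul]
    field_simp
  rw [← Real.sqrt_sq (norm_nonneg (inner ℂ v w)), Complex.ofReal_injective h2, Real.sqrt_inv,
    one_div]

/-- Commuting Hermitian matrices have a joint orthonormal eigenbasis. -/
theorem exists_orthonormalBasis_eigenvectors {n : ℕ} {ι : Type*} [Finite ι] (T : ι → Op n)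
    (hT : ∀ i, (T i)ᴴ = T i) (hc : ∀ i j, Commute (T i) (T j)) :
    ∃ B : OrthonormalBasis (Fin (2 ^ n)) ℂ (Qubits n),
      ∀ b i, ∃ μ : ℂ, toEuclideanLin (T i) (B b) = μ • B b := by
  classical
  have hsymm : ∀ i, (toEuclideanLin (T i)).IsSymmetric := fun i =>
    Matrix.isSymmetric_toEuclideanLin_iff.2 (hT i)
  have hcomm : Pairwise (Function.onFun Commute fun i => toEuclideanLin (T i)) := by
    intro i j _
    change toEuclideanLin (T i) ∘ₗ toEuclideanLin (T j) =
      toEuclideanLin (T j) ∘ₗ toEuclideanLin (T i)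
    rw [← Matrix.toLpLin_mul_same, ← Matrix.toLpLin_mul_same, (hc i j).eq]
  have hint := LinearMap.IsSymmetric.directSum_isInternal_of_pairwise_commute hsymm hcomm
  have horth := LinearMap.IsSymmetric.orthogonalFamily_iInf_eigenspaces hsymm
  -- The candidate eigenvalue families χ form an infinite type; only the finitely many with a
  -- nonzero joint eigenspace are kept.
  have hint' := DirectSum.isInternal_ne_bot_iff.2 hint
  have hfin : Fintype {χ : ι → ℂ // (⨅ j, Module.End.eigenspace (toEuclideanLin (T j)) (χ j) :
      Submodule ℂ (Qubits n)) ≠ ⊥} := hint.submodule_iSupIndep.fintypeNeBotOfFiniteDimensional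
  have hn : Module.finrank ℂ (Qubits n) = 2 ^ n := by simp
  have horth' := horth.comp (γ := {χ : ι → ℂ // (⨅ j, Module.End.eigenspace (toEuclideanLin (T j))
      (χ j) : Submodule ℂ (Qubits n)) ≠ ⊥}) Subtype.val_injective
  refine ⟨hint'.subordinateOrthonormalBasis hn horth', fun b i => ?_⟩
  have hb := hint'.subordinateOrthonormalBasis_subordinate hn b horth'
  rw [Submodule.mem_iInf] at hb
  exact ⟨_, Module.End.mem_eigenspace_iff.1 (hb i)⟩

/-! ### Involutions with a single fixed point -/

/-- `τ` is an involution whose only fixed point is `k`. -/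
structure IsPairing {P : Type*} (τ : Equiv.Perm P) (k : P) : Prop where
  apply_apply : ∀ x, τ (τ x) = x
  apply_eq_iff : ∀ x, τ x = x ↔ x = k

theorem IsPairing.conj {P : Type*} {τ : Equiv.Perm P} {k : P} (h : IsPairing τ k)
    (π : Equiv.Perm P) : IsPairing (π * τ * π⁻¹) (π k) where
  apply_apply x := by simp [h.apply_apply]
  apply_eq_iff x := by
    have : π (τ (π⁻¹ x)) = x ↔ τ (π⁻¹ x) = π⁻¹ x := by
      rw [Equiv.Perm.eq_inv_iff_eq]
    simp only [Equiv.Perm.mul_apply]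
    rw [this, h.apply_eq_iff, Equiv.Perm.inv_eq_iff_eq, eq_comm]

/-- The two equal values on each pair cancel modulo 2, leaving the fixed point. This is the source
of every parity identity below. -/
theorem IsPairing.sum_eq {P : Type*} [Fintype P] [DecidableEq P] {τ : Equiv.Perm P} {k : P}
    (h : IsPairing τ k) {f : P → ZMod 2} (hf : ∀ x, f (τ x) = f x) : ∑ x, f x = f k := by
  rw [← Finset.add_sum_erase _ _ (Finset.mem_univ k)]
  rw [Finset.sum_involution (fun x _ => τ x), add_zero]
  · intro x _
    rw [hf]
    exact CharTwo.add_self_eq_zero _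
  · intro x hx _
    rw [Ne, h.apply_eq_iff]
    exact Finset.ne_of_mem_erase hx
  · intro x hx
    refine Finset.mem_erase.2 ⟨fun hxk => Finset.ne_of_mem_erase hx ?_, Finset.mem_univ _⟩
    rw [← h.apply_apply x, hxk, (h.apply_eq_iff k).2 rfl]
  · intro x _
    exact h.apply_apply x

theorem IsPairing.card_lt {n : ℕ} {τ : Equiv.Perm (Fin (2 * n + 1))} {k : Fin (2 * n + 1)}
    (h : IsPairing τ k) : Fintype.card {x // x < τ x} = n := by
  rw [Fintype.card_subtype]
  have h1 : (Finset.univ.filter fun x => τ x < x).card =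
      (Finset.univ.filter fun x => x < τ x).card := by
    refine Finset.card_bij (fun x _ => τ x) ?_ ?_ ?_
    · intro x hx; simpa [h.apply_apply] using hx
    · intro x _ y _ hxy; exact τ.injective hxy
    · intro x hx; exact ⟨τ x, by simpa [h.apply_apply] using hx, h.apply_apply x⟩
  have h2 : (Finset.univ.filter fun x => τ x = x) = {k} := by
    ext x; simp [h.apply_eq_iff]
  have h3 := Finset.card_filter_add_card_filter_not (s := Finset.univ) (fun x => x < τ x)
  have h4 := Finset.card_filter_add_card_filter_not
    (s := Finset.univ.filter fun x => ¬ x < τ x) (fun x => τ x < x)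
  have h5 : ((Finset.univ.filter fun x => ¬ x < τ x).filter fun x => τ x < x) =
      Finset.univ.filter fun x => τ x < x := by
    ext x; simpa using fun hx => hx.le
  have h6 : ((Finset.univ.filter fun x => ¬ x < τ x).filter fun x => ¬ τ x < x) =
      Finset.univ.filter fun x => τ x = x := by
    ext x; simpa using le_antisymm_iff.symm
  rw [h5, h6, h2, h1, Finset.card_singleton] at h4
  rw [Finset.card_univ, Fintype.card_fin] at h3
  omega

/-! ### The family of Clifford products attached to an involution -/

/-- The subsets of `{0, …, 2n-1}` that are invariant under a permutation `τ` of `{0, …, 2n}`. -/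
def invariantSets {n : ℕ} (τ : Equiv.Perm (Fin (2 * n + 1))) : Finset (Finset (Fin (2 * n))) :=
  Finset.univ.filter fun A => ∀ x, ind A (τ x) = ind A x

theorem mem_invariantSets {n : ℕ} {τ : Equiv.Perm (Fin (2 * n + 1))} {A : Finset (Fin (2 * n))} :
    A ∈ invariantSets τ ↔ ∀ x, ind A (τ x) = ind A x := by
  simp [invariantSets]

theorem ind_empty {n : ℕ} (x : Fin (2 * n + 1)) : ind (∅ : Finset (Fin (2 * n))) x = 0 := by
  simp [ind]

theorem empty_mem_invariantSets {n : ℕ} (τ : Equiv.Perm (Fin (2 * n + 1))) :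
    ∅ ∈ invariantSets τ := by
  simp [mem_invariantSets, ind_empty]

namespace IsPairing

variable {n : ℕ} {τ : Equiv.Perm (Fin (2 * n + 1))} {k : Fin (2 * n + 1)}

/-- An invariant subset modulo complement amounts to one free bit for each of the n pairs, measured
relative to its value at k. -/
theorem card_invariantSets (h : IsPairing τ k) : (invariantSets τ).card = 2 ^ n := by
  have hk : τ k = k := (h.apply_eq_iff k).2 rfl
  let φ : invariantSets τ → ({x // x < τ x} → ZMod 2) := fun A q => ind A.1 q.1 + ind A.1 k
  have hφ : Function.Bijective φ := by
    constructor
    · rintro ⟨A, hA⟩ ⟨B, hB⟩ hAB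
      rw [mem_invariantSets] at hA hB
      have h1 : ∀ x, x < τ x → ind A x + ind A k = ind B x + ind B k := fun x hx =>
        congrFun hAB ⟨x, hx⟩
      have h2 : ∀ x, ind A x + ind A k = ind B x + ind B k := fun x => by
        rcases lt_trichotomy x (τ x) with hx | hx | hx
        · exact h1 x hx
        · rw [(h.apply_eq_iff x).1 hx.symm, CharTwo.add_self_eq_zero, CharTwo.add_self_eq_zero]
        · rw [← hA, ← hB]
          exact h1 _ (by rwa [h.apply_apply])
      have h3 := h2 (Fin.last _)
      rw [ind_last, ind_last, zero_add, zero_add] at h3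
      refine Subtype.ext (ind_injective (funext fun x => ?_))
      have := h2 x
      rw [h3] at this
      exact add_right_cancel this
    · intro g
      let F : Fin (2 * n + 1) → ZMod 2 := fun x =>
        if hx : x < τ x then g ⟨x, hx⟩
        else if hx : τ x < τ (τ x) then g ⟨τ x, hx⟩ else 0
      have hF : ∀ x, F (τ x) = F x := fun x => by
        by_cases h1 : x < τ x
        · simp only [F, h1, h1.asymm, dite_true, dite_false, h.apply_apply]
        · by_cases h2 : τ x < τ (τ x)
          · simp only [F, h2, h1, dite_true, dite_false]
          · simp only [F, h1, dite_false, h.apply_apply]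
      -- Adding the value at 2n passes to the complement when needed, so that the set omits 2n.
      obtain ⟨A, hA⟩ := exists_ind_eq (fun x => F x + F (Fin.last _))
        (CharTwo.add_self_eq_zero _)
      refine ⟨⟨A, mem_invariantSets.2 fun x => ?_⟩, funext fun q => ?_⟩
      · simp only [hA, hF]
      · have h1 : F q.1 = g q := by simp only [F, q.2, dite_true]
        have h2 : F k = 0 := by simp [F, hk]
        simp only [φ, hA, h1, h2]
        linear_combination CharTwo.add_self_eq_zero (F (Fin.last _))
  have hcard := Fintype.card_of_bijective hφ
  rw [Fintype.card_coe, Fintype.card_fun, ZMod.card, h.card_lt] at hcard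
  exact hcard

/-- By `sum_eq`, |A|, |B| and |A ∩ B| have the parities of `ind A k`, `ind B k` and their product,
so the exponent |A||B| + |A ∩ B| vanishes. -/
theorem commute_of_mem (h : IsPairing τ k) {A B : Finset (Fin (2 * n))}
    (hA : A ∈ invariantSets τ) (hB : B ∈ invariantSets τ) :
    Commute (cliffordProduct n A) (cliffordProduct n B) := by
  rw [mem_invariantSets] at hA hB
  have hs : (∑ x, ind A x * ind B x) = ind A k * ind B k :=
    h.sum_eq (f := fun x => ind A x * ind B x) fun x => by rw [hA, hB]
  change _ * _ = _ * _
  rw [cliffordProduct_mul_cliffordProduct, hs, ← sum_ind, ← sum_ind, h.sum_eq hA, h.sum_eq hB,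
    CharTwo.add_self_eq_zero, sgn_zero, one_smul]

/-- The generator `Γ_x` belongs to the family attached to `τ` if and only if `x` is fixed. -/
theorem exists_cliffordProduct_eq_Γ_iff (h : IsPairing τ k) (x : Fin (2 * n + 1)) :
    (∃ A ∈ invariantSets τ, cliffordProduct n A = Γ n x) ↔ x = k := by
  -- Γ_x comes from {x} if x < 2n and from the full set, the complement of {2n}, if x = 2n. The
  -- constant c records which case occurs.
  obtain ⟨A, hA, hind⟩ : ∃ A, cliffordProduct n A = Γ n x ∧
      ∃ c, ∀ y, ind A y = c + if y = x then 1 else 0 := by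
    induction x using Fin.lastCases with
    | last =>
      refine ⟨Finset.univ, cliffordProduct_univ n, 1, fun y => ?_⟩
      induction y using Fin.lastCases with
      | last => rw [ind_last, if_pos rfl, CharTwo.add_self_eq_zero]
      | cast l => simp [ind_castSucc, Fin.castSucc_ne_last]
    | cast l =>
      refine ⟨{l}, cliffordProduct_singleton l, 0, fun y => ?_⟩
      induction y using Fin.lastCases with
      | last => simp [ind_last, (Fin.castSucc_ne_last l).symm]
      | cast l' => simp [ind_castSucc]
  obtain ⟨c, hc⟩ := hind
  have hiff : (∃ A ∈ invariantSets τ, cliffordProduct n A = Γ n x) ↔ A ∈ invariantSets τ := by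
    constructor
    · rintro ⟨B, hB, hBx⟩
      rwa [cliffordProduct_injective n (hA.trans hBx.symm)]
    · exact fun hAm => ⟨A, hAm, hA⟩
  rw [hiff, mem_invariantSets, ← h.apply_eq_iff]
  constructor
  · intro hinv
    have := hinv x
    rw [hc, hc, if_pos rfl, add_right_inj] at this
    by_contra hne
    rw [if_neg hne] at this
    exact absurd this (by decide)
  · intro hx y
    rw [hc, hc]
    congr 2
    refine propext ⟨fun hy => τ.injective (hy.trans hx.symm), fun hy => by rw [hy, hx]⟩

end IsPairing

/-! ### Cyclic pairings -/

/-- `σ` is an even permutation of order dividing `L` and `τ` an involution with the single fixed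
point `k`, such that a subset that is invariant under `τ` and under a conjugate of `τ` by a
nontrivial power of `σ` is empty or everything. -/
structure IsCyclicPairing {P : Type*} [Fintype P] [DecidableEq P] (L : ℕ) (σ τ : Equiv.Perm P)
    (k : P) : Prop where
  sign_eq_one : Equiv.Perm.sign σ = 1
  pow_eq_one : σ ^ L = 1
  isPairing : IsPairing τ k
  -- The premise on k follows from the two invariances, since both values equal the sum of f;
  -- stating it spares each construction this argument.
  eq_of_invariant : ∀ j : ℕ, ¬ L ∣ j → ∀ f : P → ZMod 2, f k = f ((σ ^ j) k) →
    (∀ x, f (τ x) = f x) → (∀ x, f ((σ ^ j) (τ x)) = f ((σ ^ j) x)) → ∀ x, f x = f k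

theorem permCongr_pow {P Q : Type*} (e : P ≃ Q) (σ : Equiv.Perm P) (j : ℕ) :
    e.permCongr σ ^ j = e.permCongr (σ ^ j) :=
  (map_pow e.permCongrHom σ j).symm

theorem IsCyclicPairing.permCongr {P Q : Type*} [Fintype P] [DecidableEq P] [Fintype Q]
    [DecidableEq Q] {L : ℕ} {σ τ : Equiv.Perm P} {k : P} (h : IsCyclicPairing L σ τ k)
    (e : P ≃ Q) : IsCyclicPairing L (e.permCongr σ) (e.permCongr τ) (e k) where
  sign_eq_one := by rw [Equiv.Perm.sign_permCongr, h.sign_eq_one]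
  pow_eq_one := by rw [permCongr_pow, h.pow_eq_one]; exact e.permCongr_refl
  isPairing :=
    { apply_apply := fun x => by simp [h.isPairing.apply_apply]
      apply_eq_iff := fun x => by
        rw [Equiv.permCongr_apply, ← Equiv.eq_symm_apply, h.isPairing.apply_eq_iff,
          Equiv.symm_apply_eq] }
  eq_of_invariant j hj f h0 h1 h2 x := by
    rw [permCongr_pow] at h0 h2
    have := h.eq_of_invariant j hj (fun y => f (e y)) (by simpa using h0)
      (fun y => by simpa using h1 (e y)) (fun y => by simpa using h2 (e y)) (e.symm x)
    simpa using this

-- Periodic and symmetric functions on `ℤ/L`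

section ZMod

variable {L : ℕ} [Fact L.Prime]

theorem eq_of_periodic {α : Type*} {f : ZMod L → α} {a : ZMod L} (ha : a ≠ 0)
    (hf : ∀ x, f (x + a) = f x) (x : ZMod L) : f x = f 0 := by
  have h : ∀ m : ℕ, f (m * a) = f 0 := fun m => by
    induction m with
    | zero => simp
    | succ m ih => rw [Nat.cast_succ, add_mul, one_mul, hf, ih]
  have := h (x / a).val
  rwa [ZMod.natCast_val, ZMod.cast_id, div_mul_cancel₀ _ ha] at this

theorem two_ne_zero_of_odd (hL : L ≠ 2) : (2 : ZMod L) ≠ 0 := by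
  intro h
  have : ((2 : ℕ) : ZMod L) = 0 := by exact_mod_cast h
  rw [ZMod.natCast_eq_zero_iff] at this
  exact hL ((Nat.prime_dvd_prime_iff_eq Fact.out Nat.prime_two).1 this)

theorem isPairing_neg (hL : L ≠ 2) : IsPairing (Equiv.neg (ZMod L)) 0 where
  apply_apply x := neg_neg x
  apply_eq_iff x := by
    constructor
    · intro h
      have h2 : (2 : ZMod L) * x = 0 := by
        have : -x = x := h
        linear_combination -this
      exact (mul_eq_zero.1 h2).resolve_left (two_ne_zero_of_odd hL)
    · rintro rfl; exact neg_zero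

/-- A function symmetric about both `0` and `j ≠ 0` is constant. -/
theorem eq_of_symmetric {α : Type*} (hL : L ≠ 2) {f : ZMod L → α} {j : ZMod L} (hj : j ≠ 0)
    (h0 : ∀ x, f (-x) = f x) (h1 : ∀ x, f (-x + j) = f (x + j)) (x : ZMod L) : f x = f 0 := by
  -- The composite of the reflections about 0 and j is the translation by 2j.
  refine eq_of_periodic (a := 2 * j) (mul_ne_zero (two_ne_zero_of_odd hL) hj) (fun y => ?_) x
  rw [← h0 y, show y + 2 * j = (y + j) + j by ring, ← h1]
  congr 1
  ring

/-- A variant of `eq_of_symmetric` where the pairs `±1` and `j ± 1` are exceptional. -/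
theorem eq_of_symmetric_of_ne (hL : L ≠ 2) {f : ZMod L → ZMod 2} {j : ZMod L} (hj : j ≠ 0)
    (h0 : ∀ x, x ≠ 1 → x ≠ -1 → f (-x) = f x)
    (h1 : ∀ x, x ≠ 1 → x ≠ -1 → f (-x + j) = f (x + j))
    (hf : f 0 = f j) (hf1 : f 1 = f (1 + j)) (x : ZMod L) : f x = f 0 := by
  have hne : (1 : ZMod L) ≠ -1 := fun h => two_ne_zero_of_odd hL (by linear_combination h)
  -- Changing g at the point 1 makes it symmetric, after which `sum_eq` applies.
  have parity : ∀ g : ZMod L → ZMod 2, (∀ x, x ≠ 1 → x ≠ -1 → g (-x) = g x) →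
      ∑ x, g x = g 0 + (g 1 + g (-1)) := fun g hg => by
    have h := (isPairing_neg hL).sum_eq
      (f := fun x => g x + if x = 1 then g 1 + g (-1) else 0) (fun x => by
        change g (-x) + (if -x = 1 then _ else _) = _
        by_cases hx1 : x = 1
        · subst hx1
          rw [if_neg hne.symm, if_pos rfl]
          linear_combination -CharTwo.add_self_eq_zero (g 1)
        by_cases hx2 : x = -1
        · subst hx2
          rw [neg_neg, if_pos rfl, if_neg hne.symm]
          linear_combination CharTwo.add_self_eq_zero (g 1)
        rw [if_neg hx1, if_neg (fun h => hx2 (by rw [← h, neg_neg])), hg x hx1 hx2])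
    simp only [Finset.sum_add_distrib, Finset.sum_ite_eq', Finset.mem_univ, if_true,
      if_neg (zero_ne_one (α := ZMod L)), add_zero] at h
    linear_combination h - CharTwo.add_self_eq_zero (g 1 + g (-1))
  -- The sum over ℤ/L does not change under translation by j, so the two parity formulas can be
  -- compared.
  have hD : f (-1) = f (-1 + j) := by
    have ha := parity f h0
    have hb := parity (fun x => f (x + j)) h1
    rw [show ∑ x, f (x + j) = ∑ x, f x from Equiv.sum_comp (Equiv.addRight j) f, zero_add, ha, hf, hf1] at hb
    exact add_left_cancel (add_left_cancel hb)
  set D := f 1 + f (-1) with hDdef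
  have h0' : ∀ x, f x + f (-x) = if x = 1 ∨ x = -1 then D else 0 := fun x => by
    split_ifs with hx
    · rcases hx with rfl | rfl
      · rfl
      · rw [neg_neg, add_comm]
    · push Not at hx
      rw [h0 x hx.1 hx.2, CharTwo.add_self_eq_zero]
  have h1' : ∀ x, f (x + j) + f (-x + j) = if x = 1 ∨ x = -1 then D else 0 := fun x => by
    split_ifs with hx
    · rcases hx with rfl | rfl
      · rw [← hf1, ← hD]
      · rw [neg_neg, ← hf1, ← hD, add_comm]
    · push Not at hx
      rw [h1 x hx.1 hx.2, CharTwo.add_self_eq_zero]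
  -- Both symmetries fail by the same defect D, so this expression at x and at x + j equals f(x + j)
  -- + f(−x). It is thus constant; x = 1 gives D = 0, and then f has period j.
  have hg : ∀ x, f x + f (x + j) + (if x = 1 ∨ x = -1 then D else 0) = f 0 + f j := fun x => by
    have := eq_of_periodic (f := fun x => f x + f (x + j) + (if x = 1 ∨ x = -1 then D else 0)) hj
      (fun x => ?_) x
    · simpa using this
    · rw [← h0' x, ← h1' (x + j), show -(x + j) + j = -x by ring]
      linear_combination
        CharTwo.add_self_eq_zero (f (x + j + j)) - CharTwo.add_self_eq_zero (f x)
  have hD0 : D = 0 := by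
    have := hg 1
    rw [← hf1, ← hf, CharTwo.add_self_eq_zero, CharTwo.add_self_eq_zero, if_pos (Or.inl rfl),
      zero_add] at this
    exact this
  refine eq_of_periodic hj (fun x => ?_) x
  have := hg x
  rw [hD0, ite_self, add_zero, ← hf, CharTwo.add_self_eq_zero] at this
  exact (CharTwo.add_eq_zero.1 this).symm

theorem addRight_pow_apply (j : ℕ) (x : ZMod L) : (Equiv.addRight (1 : ZMod L) ^ j) x = x + j := by
  induction j with
  | zero => simp
  | succ j ih => rw [pow_succ', Equiv.Perm.mul_apply, ih]; simp [add_assoc]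

/-- The cyclic shift and the inversion of `ℤ/L` for an odd prime `L`. -/
theorem isCyclicPairing_neg (hL : L ≠ 2) :
    IsCyclicPairing L (Equiv.addRight (1 : ZMod L)) (Equiv.neg (ZMod L)) 0 := by
  have hpow : Equiv.addRight (1 : ZMod L) ^ L = 1 := by
    ext x; simp
  refine ⟨?_, hpow, isPairing_neg hL, fun j hj f _ h1 h2 x => ?_⟩
  -- A permutation of odd order is even.
  · have hodd : Odd L := (Fact.out : L.Prime).odd_of_ne_two hL
    have h := congrArg Equiv.Perm.sign hpow
    rw [map_pow, map_one] at h
    rcases Int.units_eq_one_or (Equiv.Perm.sign (Equiv.addRight (1 : ZMod L))) with h' | h'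
    · exact h'
    · rw [h', hodd.neg_one_pow] at h
      exact absurd h (by decide)
  · have hj' : (j : ZMod L) ≠ 0 := by rwa [Ne, ZMod.natCast_eq_zero_iff]
    exact eq_of_symmetric hL hj' h1 (fun y => by simpa [addRight_pow_apply] using h2 y) x

/-! ### Cyclic shifts of several blocks and a fixed point -/

/-- The cyclic shift of each of `N` blocks of length `L`, with an additional fixed point. -/
def shiftBlocks (N L : ℕ) : Equiv.Perm (Option (Fin N × ZMod L)) :=
  (Equiv.prodCongrRight fun _ => Equiv.addRight (1 : ZMod L)).optionCongr

theorem shiftBlocks_some (N : ℕ) (a : Fin N) (x : ZMod L) :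
    shiftBlocks N L (some (a, x)) = some (a, x + 1) := rfl

theorem shiftBlocks_pow_none (N M j : ℕ) : (shiftBlocks N M ^ j) none = none := by
  induction j with
  | zero => rfl
  | succ j ih => rw [pow_succ', Equiv.Perm.mul_apply, ih]; rfl

theorem shiftBlocks_pow_some (N j : ℕ) (a : Fin N) (x : ZMod L) :
    (shiftBlocks N L ^ j) (some (a, x)) = some (a, x + j) := by
  induction j with
  | zero => simp
  | succ j ih => rw [pow_succ', Equiv.Perm.mul_apply, ih, shiftBlocks_some]; simp [add_assoc]

theorem shiftBlocks_pow_self (N : ℕ) : shiftBlocks N L ^ L = 1 := by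
  ext1 p
  rcases p with _ | ⟨a, x⟩
  · exact shiftBlocks_pow_none N L L
  · simp [shiftBlocks_pow_some]

theorem sign_shiftBlocks {N : ℕ} (hN : Even N) : Equiv.Perm.sign (shiftBlocks N L) = 1 := by
  rw [shiftBlocks, Equiv.optionCongr_sign, Equiv.Perm.sign_prodCongrRight, Finset.prod_const,
    Finset.card_univ, Fintype.card_fin]
  obtain ⟨m, rfl⟩ := hN
  rw [← two_mul, pow_mul, Int.units_sq, one_pow]

end ZMod

/-! ### The pairing for blocks of length two -/

/-- The involution that pairs the second point of each block with the first point of the next block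
and the second point of the last block with the additional point. -/
def chainPairingFun (N : ℕ) : Option (Fin N × ZMod 2) → Option (Fin N × ZMod 2)
  | none => if h : 0 < N then some (⟨N - 1, by omega⟩, 1) else none
  | some (a, x) =>
    if x = 0 then
      if h : 0 < (a : ℕ) then some (⟨a - 1, by omega⟩, 1) else some (a, 0)
    else if h : (a : ℕ) + 1 < N then some (⟨a + 1, h⟩, 0) else none

theorem chainPairingFun_involutive (N : ℕ) : Function.Involutive (chainPairingFun N) := by
  have h10 : (1 : ZMod 2) ≠ 0 := by decide
  rintro (_ | ⟨⟨a, ha⟩, x⟩)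
  · by_cases h : 0 < N
    · have h' : ¬ N - 1 + 1 < N := by omega
      simp [chainPairingFun, h, h10, h']
    · simp [chainPairingFun, h]
  · rcases zmod_two_cases x with rfl | rfl
    · by_cases h : 0 < a
      · have h' : a - 1 + 1 = a := by omega
        simp [chainPairingFun, h, h', ha]
      · simp [chainPairingFun, h]
    · by_cases h : a + 1 < N
      · simp [chainPairingFun, h]
      · have h' : 0 < N := by omega
        have h'' : N - 1 = a := by omega
        simp [chainPairingFun, h, h', h'']

theorem isPairing_chainPairingFun {N : ℕ} (hN : 0 < N) :
    IsPairing (chainPairingFun_involutive N).toPerm (some (⟨0, hN⟩, 0)) where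
  apply_apply := chainPairingFun_involutive N
  apply_eq_iff := by
    have h10 : (1 : ZMod 2) ≠ 0 := by decide
    rintro (_ | ⟨⟨a, ha⟩, x⟩)
    · simp [chainPairingFun, hN]
    · rcases zmod_two_cases x with rfl | rfl
      · by_cases h : 0 < a
        · simp [chainPairingFun, h, h.ne']
        · simp [chainPairingFun, Nat.eq_zero_of_not_pos h]
      · by_cases h : a + 1 < N
        · simp [chainPairingFun, h]
        · simp [chainPairingFun, h]

/-- For odd j, the power σ^j exchanges the two points of each block. The chain and its shift then
link both points of a block to those of the next one, so constancy spreads from block 0 and finally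
reaches the extra point. -/
theorem isCyclicPairing_chainPairingFun {N : ℕ} (hN : 0 < N) (hN2 : Even N) :
    IsCyclicPairing 2 (shiftBlocks N 2) (chainPairingFun_involutive N).toPerm
      (some (⟨0, hN⟩, 0)) := by
  have : Fact (Nat.Prime 2) := ⟨Nat.prime_two⟩
  refine ⟨sign_shiftBlocks hN2, shiftBlocks_pow_self N, isPairing_chainPairingFun hN,
    fun j hj f h0 h1 h2 => ?_⟩
  have hj1 : (j : ZMod 2) = 1 := by
    refine (zmod_two_cases _).resolve_left ?_
    rwa [ZMod.natCast_eq_zero_iff]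
  have h11 : (1 + 1 : ZMod 2) = 0 := CharTwo.add_self_eq_zero 1
  rw [shiftBlocks_pow_some, hj1, zero_add] at h0
  have key : ∀ a (ha : a < N), f (some (⟨a, ha⟩, 0)) = f (some (⟨0, hN⟩, 0)) ∧
      f (some (⟨a, ha⟩, 1)) = f (some (⟨0, hN⟩, 0)) := by
    intro a
    induction a with
    | zero => exact fun _ => ⟨rfl, h0.symm⟩
    | succ a ih =>
      intro ha
      have ih := ih (by omega)
      have e1 := h1 (some (⟨a, by omega⟩, 1))
      have e2 := h2 (some (⟨a, by omega⟩, 1))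
      simp [chainPairingFun, ha, shiftBlocks_pow_some, hj1, h11] at e1 e2
      exact ⟨e1.trans ih.2, e2.trans ih.1⟩
  rintro (_ | ⟨⟨a, ha⟩, x⟩)
  · have e1 := h1 none
    simp only [Function.Involutive.coe_toPerm, chainPairingFun, hN, dite_true] at e1
    rw [← e1]
    exact (key _ _).2
  · rcases zmod_two_cases x with rfl | rfl
    · exact (key a ha).1
    · exact (key a ha).2

/-! ### The pairing for blocks of odd length -/

/-- The involution that reflects each block about its origin, except that in the blocks of even
index the point `1` is paired with the origin of the next block, and `-1` with the origin of the
next block of even index or, in the last of these, with the additional point. -/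
def reflectPairingFun (m L : ℕ) : Option (Fin (2 * m) × ZMod L) → Option (Fin (2 * m) × ZMod L)
  | none => if h : 0 < m then some (⟨2 * m - 2, by omega⟩, -1) else none
  | some (a, x) =>
    if ha : (a : ℕ) % 2 = 0 then
      if x = 0 then
        if h : 0 < (a : ℕ) then some (⟨a - 2, by omega⟩, -1) else some (a, 0)
      else if x = 1 then some (⟨a + 1, by omega⟩, 0)
      else if x = -1 then
        if h : (a : ℕ) + 2 < 2 * m then some (⟨a + 2, h⟩, 0) else none
      else some (a, -x)
    else if x = 0 then some (⟨a - 1, by omega⟩, 1) else some (a, -x)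

section

variable {L : ℕ} [Fact L.Prime]

theorem one_ne_neg_one_of_odd (hL : L ≠ 2) : (1 : ZMod L) ≠ -1 := fun h =>
  two_ne_zero_of_odd hL (by linear_combination h)

theorem reflectPairingFun_involutive (m : ℕ) (hL : L ≠ 2) :
    Function.Involutive (reflectPairingFun m L) := by
  have hne : (1 : ZMod L) ≠ -1 := one_ne_neg_one_of_odd hL
  have hne' : (-1 : ZMod L) ≠ 1 := hne.symm
  rintro (_ | ⟨⟨a, ha⟩, x⟩)
  · by_cases h : 0 < m
    · have h1 : (2 * m - 2) % 2 = 0 := by omega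
      have h2 : ¬ 2 * m - 2 + 2 < 2 * m := by omega
      simp [reflectPairingFun, h, h1, h2, hne']
    · simp [reflectPairingFun, h]
  by_cases ha2 : a % 2 = 0
  · by_cases hx0 : x = 0
    · subst hx0
      by_cases h : 0 < a
      · have h1 : (a - 2) % 2 = 0 := by omega
        have h2 : a - 2 + 2 = a := by omega
        simp [reflectPairingFun, h, ha2, h1, h2, hne', ha]
      · simp [reflectPairingFun, h, ha2]
    by_cases hx1 : x = 1
    · subst hx1
      have h1 : (a + 1) % 2 ≠ 0 := by omega
      simp [reflectPairingFun, ha2, h1]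
    by_cases hx2 : x = -1
    · subst hx2
      by_cases h : a + 2 < 2 * m
      · simp [reflectPairingFun, ha2, h, hne']
      · have h1 : 0 < m := by omega
        have h2 : 2 * m - 2 = a := by omega
        simp [reflectPairingFun, ha2, h, hne', h1, h2]
    · have h1 : -x ≠ 1 := fun h => hx2 (by rw [← h, neg_neg])
      have h2 : -x ≠ -1 := fun h => hx1 (neg_injective h)
      simp [reflectPairingFun, ha2, hx0, hx1, hx2, h1]
  · by_cases hx0 : x = 0
    · subst hx0
      have h1 : (a - 1) % 2 = 0 := by omega
      have h2 : a - 1 + 1 = a := by omega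
      simp [reflectPairingFun, ha2, h1, h2]
    · simp [reflectPairingFun, ha2, hx0]

theorem isPairing_reflectPairingFun {m : ℕ} (hm : 0 < 2 * m) (hL : L ≠ 2) :
    IsPairing (reflectPairingFun_involutive m hL).toPerm (some (⟨0, hm⟩, 0)) where
  apply_apply := reflectPairingFun_involutive m hL
  apply_eq_iff := by
    have hm' : 0 < m := by omega
    have hne : (1 : ZMod L) ≠ -1 := one_ne_neg_one_of_odd hL
    have hne' : (-1 : ZMod L) ≠ 1 := hne.symm
    have hneg : ∀ x : ZMod L, x ≠ 0 → -x ≠ x := fun x hx h =>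
      hx (((isPairing_neg hL).apply_eq_iff x).1 h)
    rintro (_ | ⟨⟨a, ha⟩, x⟩)
    · simp [reflectPairingFun, hm']
    by_cases ha2 : a % 2 = 0
    · by_cases hx0 : x = 0
      · subst hx0
        by_cases h : 0 < a
        · simp [reflectPairingFun, h, h.ne', ha2]
        · simp [reflectPairingFun, Nat.eq_zero_of_not_pos h]
      by_cases hx1 : x = 1
      · subst hx1
        simp [reflectPairingFun, ha2]
      by_cases hx2 : x = -1
      · subst hx2
        by_cases h : a + 2 < 2 * m
        · simp [reflectPairingFun, ha2, h, hne']
        · simp [reflectPairingFun, ha2, h, hne']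
      · simp [reflectPairingFun, ha2, hx0, hx1, hx2, hneg x hx0]
    · have ha0 : a ≠ 0 := by rintro rfl; exact ha2 rfl
      by_cases hx0 : x = 0
      · subst hx0
        simp [reflectPairingFun, ha2, ha0]
      · simp [reflectPairingFun, ha2, hx0, hneg x hx0]

/-- Blocks of odd index carry the full reflection, so f is constant on them by `eq_of_symmetric`. In
a block of even index the pair ±1 has been broken up to link the blocks, and `eq_of_symmetric_of_ne`
takes over. Constancy travels along the even blocks through the points −1. -/
theorem isCyclicPairing_reflectPairingFun {m : ℕ} (hm : 0 < 2 * m) (hL : L ≠ 2) :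
    IsCyclicPairing L (shiftBlocks (2 * m) L) (reflectPairingFun_involutive m hL).toPerm
      (some (⟨0, hm⟩, 0)) := by
  refine ⟨sign_shiftBlocks (even_two_mul m), shiftBlocks_pow_self _,
    isPairing_reflectPairingFun hm hL, fun j hj f h0 h1 h2 => ?_⟩
  have hj' : (j : ZMod L) ≠ 0 := by rwa [Ne, ZMod.natCast_eq_zero_iff]
  have hne' : (-1 : ZMod L) ≠ 1 := (one_ne_neg_one_of_odd hL).symm
  rw [shiftBlocks_pow_some, zero_add] at h0
  have hodd : ∀ a (ha : a < 2 * m), a % 2 = 1 → ∀ x, f (some (⟨a, ha⟩, x)) =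
      f (some (⟨a, ha⟩, 0)) := fun a ha ha2 => by
    refine eq_of_symmetric hL (f := fun x => f (some (⟨a, ha⟩, x))) hj' (fun x => ?_) (fun x => ?_)
    · by_cases hx : x = 0
      · rw [hx, neg_zero]
      · simpa [reflectPairingFun, ha2, hx] using h1 (some (⟨a, ha⟩, x))
    · by_cases hx : x = 0
      · rw [hx, neg_zero]
      · simpa [reflectPairingFun, ha2, hx, shiftBlocks_pow_some] using h2 (some (⟨a, ha⟩, x))
  have heven : ∀ b (hb : 2 * b < 2 * m),
      f (some (⟨2 * b, hb⟩, 0)) = f (some (⟨2 * b, hb⟩, (j : ZMod L))) →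
      ∀ x, f (some (⟨2 * b, hb⟩, x)) = f (some (⟨2 * b, hb⟩, 0)) := fun b hb h => by
    refine eq_of_symmetric_of_ne hL (f := fun x => f (some (⟨2 * b, hb⟩, x))) hj'
      (fun x hx1 hx2 => ?_) (fun x hx1 hx2 => ?_) h ?_
    · by_cases hx : x = 0
      · rw [hx, neg_zero]
      · simpa [reflectPairingFun, hx, hx1, hx2] using h1 (some (⟨2 * b, hb⟩, x))
    · by_cases hx : x = 0
      · rw [hx, neg_zero]
      · simpa [reflectPairingFun, hx, hx1, hx2, shiftBlocks_pow_some] using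
          h2 (some (⟨2 * b, hb⟩, x))
    -- The points 1 and 1 + j are linked to 0 and j in the next block, which has odd index, so f
    -- agrees on them.
    · have e1 := h1 (some (⟨2 * b, hb⟩, 1))
      have e2 := h2 (some (⟨2 * b, hb⟩, 1))
      simp [reflectPairingFun, shiftBlocks_pow_some] at e1 e2
      rw [← e1, ← e2, hodd _ _ (by omega) (j : ZMod L)]
  have key : ∀ b (hb : 2 * b < 2 * m) x,
      f (some (⟨2 * b, hb⟩, x)) = f (some (⟨0, hm⟩, 0)) := by
    intro b
    induction b with
    | zero => exact fun hb => heven 0 hb h0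
    | succ b ih =>
      intro hb x
      have ih := ih (by omega)
      -- The points −1 and −1 + j are linked to 0 and j in block 2b + 2. This supplies the
      -- hypothesis of `heven` there.
      have e1 := h1 (some (⟨2 * b, by omega⟩, -1))
      have e2 := h2 (some (⟨2 * b, by omega⟩, -1))
      have hb' : 2 * b + 2 < 2 * m := hb
      simp [reflectPairingFun, shiftBlocks_pow_some, hb', hne'] at e1 e2
      rw [ih] at e1 e2
      exact (heven (b + 1) hb (e1.trans e2.symm) x).trans e1
  rintro (_ | ⟨⟨a, ha⟩, x⟩)
  · have e1 := h1 none
    have hm' : 0 < m := by omega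
    simp only [Function.Involutive.coe_toPerm, reflectPairingFun, hm', dite_true] at e1
    rw [← e1]
    simpa only [Nat.mul_sub, mul_one] using key (m - 1) (by omega) (-1)
  · obtain ⟨b, rfl | rfl⟩ := Nat.even_or_odd' a
    · exact key b ha x
    · rw [hodd _ _ (by omega) x]
      have e1 := h1 (some (⟨2 * b, by omega⟩, 1))
      simp [reflectPairingFun] at e1
      rw [e1, key]

end

/-! ### Classes and bases attached to a cyclic pairing -/

theorem Γ_ne_one {n : ℕ} (hn : 0 < n) (x : Fin (2 * n + 1)) : Γ n x ≠ 1 := by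
  intro h
  have : Nontrivial (Fin (2 * n + 1)) := Fin.nontrivial_iff_two_le.2 (by omega)
  obtain ⟨y, hy⟩ := exists_ne x
  have h1 := trace_eq_zero_of_anticommute (Γ_mul_self y) (Γ_anticommute hy.symm)
  rw [h, Matrix.trace_one] at h1
  simp at h1

theorem toEuclideanLin_mul_apply {n : ℕ} (M N : Op n) (v : Qubits n) :
    toEuclideanLin (M * N) v = toEuclideanLin M (toEuclideanLin N v) := by
  rw [Matrix.toLpLin_mul_same, LinearMap.comp_apply]

theorem exists_linearIsometryEquiv {n : ℕ} {V : Op n} (h : Vᴴ * V = 1) :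
    ∃ W : Qubits n ≃ₗᵢ[ℂ] Qubits n, ∀ v, W v = toEuclideanLin V v := by
  let W : Qubits n →ₗᵢ[ℂ] Qubits n := (toEuclideanLin V).isometryOfInner fun x y => by
    rw [← LinearMap.adjoint_inner_right, ← Matrix.toEuclideanLin_conjTranspose_eq_adjoint,
      ← toEuclideanLin_mul_apply, h, Matrix.toLpLin_one, LinearMap.id_apply]
  exact ⟨W.toLinearIsometryEquiv rfl, fun v => rfl⟩

/-- B is π(A) or its complement, whichever omits 2n, and c tells whether the complement is taken. As
2n + 1 is odd, complementing flips both |B| and the indicator, so the signs against the generators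
are preserved. -/
theorem Implements.exists_conj_eq {n : ℕ} {V : Op n} {π τ : Equiv.Perm (Fin (2 * n + 1))}
    (h : Implements V π) {A : Finset (Fin (2 * n))} (hA : A ∈ invariantSets τ) :
    ∃ B ∈ invariantSets (π * τ * π⁻¹), (A ≠ ∅ → B ≠ ∅) ∧
      (V * cliffordProduct n A * Vᴴ = cliffordProduct n B ∨
        V * cliffordProduct n A * Vᴴ = -cliffordProduct n B) := by
  rw [mem_invariantSets] at hA
  have hinv : ∀ x, π⁻¹ (π x) = x := π.symm_apply_apply
  set c := ind A (π⁻¹ (Fin.last _)) with hc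
  obtain ⟨B, hB⟩ := exists_ind_eq (fun x => ind A (π⁻¹ x) + c) (CharTwo.add_self_eq_zero c)
  have hcard : (B.card : ZMod 2) = A.card + c := by
    rw [← sum_ind, ← sum_ind, hB, Finset.sum_add_distrib, Equiv.sum_comp π⁻¹ (ind A),
      Finset.sum_const, Finset.card_univ, Fintype.card_fin, nsmul_eq_mul, Nat.cast_succ,
      Nat.cast_mul]
    rw [show ((2 : ℕ) : ZMod 2) = 0 from rfl, zero_mul, zero_add, one_mul]
  refine ⟨B, mem_invariantSets.2 fun x => ?_, fun hne hB0 => hne ?_, h.conj_cliffordProduct ?_⟩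
  · simp [hB, hA]
  · refine ind_injective (funext fun x => ?_)
    rw [ind_empty]
    have h1 : ∀ y, ind A (π⁻¹ y) + c = 0 := fun y => by
      rw [← ind_empty y, ← hB0, hB]
    have h2 : ind A (π⁻¹ (π (Fin.last _))) + c = 0 := h1 _
    have h3 : ind A (π⁻¹ (π x)) + c = 0 := h1 _
    rw [hinv] at h2 h3
    rw [ind_last, zero_add] at h2
    rwa [h2, add_zero] at h3
  · intro x
    rw [hcard, hB]
    simp only [hinv]
    linear_combination -CharTwo.add_self_eq_zero c

theorem pow_val_add {M : Type*} [Monoid M] {L : ℕ} [NeZero L] {x : M} (hx : x ^ L = 1)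
    (i j : ZMod L) : x ^ (i + j).val = x ^ i.val * x ^ j.val := by
  rw [ZMod.val_add, ← pow_eq_pow_mod _ hx, pow_add]

namespace IsCyclicPairing

variable {n L : ℕ} {σ τ : Equiv.Perm (Fin (2 * n + 1))} {k : Fin (2 * n + 1)}

theorem inter_invariantSets [NeZero L] (h : IsCyclicPairing L σ τ k) {i j : ZMod L} (hij : i ≠ j) :
    invariantSets (σ ^ i.val * τ * (σ ^ i.val)⁻¹) ∩ invariantSets (σ ^ j.val * τ * (σ ^ j.val)⁻¹) =
      {∅} := by
  ext A
  rw [Finset.mem_inter, Finset.mem_singleton]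
  refine ⟨?_, fun hA => hA ▸ ⟨empty_mem_invariantSets _, empty_mem_invariantSets _⟩⟩
  rintro ⟨hi, hj⟩
  rw [mem_invariantSets] at hi hj
  -- The parity of |A|, computed with either involution, shows that `ind A` agrees at the two fixed
  -- points.
  have hki := (h.isPairing.conj (σ ^ i.val)).sum_eq hi
  have hkj := (h.isPairing.conj (σ ^ j.val)).sum_eq hj
  have hσ : ∀ x, (σ ^ i.val) ((σ ^ (j - i).val) x) = (σ ^ j.val) x := fun x => by
    rw [← Equiv.Perm.mul_apply, ← pow_val_add h.pow_eq_one, add_sub_cancel]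
  have hdvd : ¬ L ∣ (j - i).val := fun hd => by
    have := Nat.eq_zero_of_dvd_of_lt hd (ZMod.val_lt _)
    rw [ZMod.val_eq_zero, sub_eq_zero] at this
    exact hij this.symm
  -- Composing with σ^i reduces the pair (i, j) to (0, j − i).
  have hconst := h.eq_of_invariant _ hdvd (fun x => ind A ((σ ^ i.val) x))
    (by rw [hσ, ← hki, ← hkj])
    (fun x => by simpa using hi ((σ ^ i.val) x))
    (fun x => by rw [hσ, hσ]; simpa using hj ((σ ^ j.val) x))
  refine ind_injective (funext fun x => ?_)
  have h1 := hconst ((σ ^ i.val)⁻¹ x)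
  have h2 := hconst ((σ ^ i.val)⁻¹ (Fin.last _))
  simp only [show ∀ y, (σ ^ i.val) ((σ ^ i.val)⁻¹ y) = y from (σ ^ i.val).apply_symm_apply] at h1 h2
  rw [h1, ← h2, ind_last, ind_empty]

/-- A cyclic pairing of the generators yields cyclically permuted classes of Clifford products and
mutually unbiased bases. -/
theorem exists_classes_bases (h : IsCyclicPairing L σ τ k) (hL : 1 < L) (hn : 0 < n) :
    ∃ (U : Op n) (C : ZMod L → Set (Op n))
      (B : ZMod L → OrthonormalBasis (Fin (2 ^ n)) ℂ (Qubits n)),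
      Implements U σ ∧
      (∀ j, C j ⊆ cliffordProducts n \ {1}) ∧
      (∀ j, (C j).ncard = 2 ^ n - 1) ∧
      (∀ j, ∀ P ∈ C j, ∀ Q ∈ C j, Commute P Q) ∧
      (∀ j, ∃! k : Fin (2 * n + 1), Γ n k ∈ C j) ∧
      (∀ j k, j ≠ k → Disjoint (C j) (C k)) ∧
      (∀ j, ∀ P ∈ C j, U * P * Uᴴ ∈ C (j + 1) ∨ -(U * P * Uᴴ) ∈ C (j + 1)) ∧
      (∀ j, ∀ P ∈ C j, ∀ b, ∃ μ : ℂ,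
        Module.End.HasEigenvector (toEuclideanLin P) μ (B j b)) ∧
      (∀ j k, j ≠ k → MutuallyUnbiased (B j) (B k)) ∧
      (∀ j b, toEuclideanLin U (B j b) = B (j + 1) b) := by
  have : NeZero L := ⟨by omega⟩
  have : Fact (1 < L) := ⟨hL⟩
  obtain ⟨U, hU, hUL⟩ := exists_implements_pow_eq_one (n := n) (by omega : 0 < L) h.sign_eq_one
    h.pow_eq_one
  let S : ZMod L → Finset (Finset (Fin (2 * n))) := fun j =>
    invariantSets (σ ^ j.val * τ * (σ ^ j.val)⁻¹)
  have hpair : ∀ j : ZMod L, IsPairing (σ ^ j.val * τ * (σ ^ j.val)⁻¹) ((σ ^ j.val) k) :=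
    fun j => h.isPairing.conj _
  let C : ZMod L → Set (Op n) := fun j => cliffordProduct n '' ((S j).erase ∅ : Finset _)
  obtain ⟨B₀, hB₀⟩ := exists_orthonormalBasis_eigenvectors
    (fun A : invariantSets τ => cliffordProduct n A.1)
    (fun A => conjTranspose_cliffordProduct A.1)
    (fun A A' => h.isPairing.commute_of_mem A.2 A'.2)
  have hW : ∀ j : ZMod L, ∃ W : Qubits n ≃ₗᵢ[ℂ] Qubits n, ∀ v, W v = toEuclideanLin (U ^ j.val) v :=
    fun j => exists_linearIsometryEquiv (hU.pow j.val).1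
  choose W hW using hW
  let B : ZMod L → OrthonormalBasis (Fin (2 ^ n)) ℂ (Qubits n) := fun j => B₀.map (W j)
  have hB : ∀ j b, B j b = toEuclideanLin (U ^ j.val) (B₀ b) := fun j b => by
    simp only [B, OrthonormalBasis.map_apply, hW]
  have heig : ∀ j, ∀ A ∈ S j, ∀ b, ∃ μ : ℂ,
      toEuclideanLin (cliffordProduct n A) (B j b) = μ • B j b := by
    intro j A hA b
    have hV := hU.pow j.val
    -- Pulling back by U^j returns to the class of τ, for which B₀ is an eigenbasis; a sign only
    -- changes the eigenvalue.
    obtain ⟨A', hA', -, hAA'⟩ := hV.conjTranspose.exists_conj_eq hA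
    rw [show (σ ^ j.val)⁻¹ * (σ ^ j.val * τ * (σ ^ j.val)⁻¹) * ((σ ^ j.val)⁻¹)⁻¹ = τ by group] at hA'
    rw [conjTranspose_conjTranspose] at hAA'
    obtain ⟨μ, hμ⟩ := hB₀ b ⟨A', hA'⟩
    have hμ' : ∃ ν : ℂ, toEuclideanLin ((U ^ j.val)ᴴ * cliffordProduct n A * U ^ j.val) (B₀ b) =
        ν • B₀ b := by
      rcases hAA' with hAA' | hAA'
      · exact ⟨μ, by rw [hAA', hμ]⟩
      · exact ⟨-μ, by rw [hAA', map_neg, LinearMap.neg_apply, hμ, neg_smul]⟩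
    obtain ⟨ν, hν⟩ := hμ'
    refine ⟨ν, ?_⟩
    rw [hB, ← map_smul, ← hν, ← toEuclideanLin_mul_apply, ← toEuclideanLin_mul_apply, ← mul_assoc,
      ← mul_assoc, hV.2, one_mul]
  have hcard : ∀ j, (S j).card = 2 ^ n := fun j => (hpair j).card_invariantSets
  have hmem : ∀ j P, P ∈ C j ↔ ∃ A ∈ S j, A ≠ ∅ ∧ cliffordProduct n A = P := fun j P => by
    simp only [C, Set.mem_image, Finset.mem_coe, Finset.mem_erase]
    exact ⟨fun ⟨A, ⟨h1, h2⟩, h3⟩ => ⟨A, h2, h1, h3⟩, fun ⟨A, h1, h2, h3⟩ => ⟨A, ⟨h2, h1⟩, h3⟩⟩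
  have hΓ : ∀ j (x : Fin (2 * n + 1)), Γ n x ∈ C j ↔ x = (σ ^ j.val) k := fun j x => by
    rw [hmem, ← (hpair j).exists_cliffordProduct_eq_Γ_iff x]
    refine exists_congr fun A => and_congr_right fun _ => and_iff_right_of_imp ?_
    rintro hA rfl
    exact Γ_ne_one hn x (hA.symm.trans (cliffordProduct_empty n))
  refine ⟨U, C, B, hU, fun j P hP => ?_, fun j => ?_, fun j P hP Q hQ => ?_, fun j => ?_,
    fun i j hij => ?_, fun j P hP => ?_, fun j P hP b => ?_, fun i j hij a b => ?_, fun j b => ?_⟩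
  · obtain ⟨A, -, hA, rfl⟩ := (hmem j P).1 hP
    refine ⟨⟨A, rfl⟩, fun h1 => hA (cliffordProduct_injective n ?_)⟩
    rw [cliffordProduct_empty]
    exact h1
  · rw [Set.ncard_image_of_injective _ (cliffordProduct_injective n), Set.ncard_coe_finset,
      Finset.card_erase_of_mem (empty_mem_invariantSets _), hcard]
  · obtain ⟨A, hA, -, rfl⟩ := (hmem j P).1 hP
    obtain ⟨A', hA', -, rfl⟩ := (hmem j Q).1 hQ
    exact (hpair j).commute_of_mem hA hA'
  · exact ⟨_, (hΓ j _).2 rfl, fun x hx => (hΓ j x).1 hx⟩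
  · rw [Set.disjoint_left]
    intro P hi hj
    obtain ⟨A, hA, hne, rfl⟩ := (hmem i P).1 hi
    obtain ⟨A', hA', -, hAA'⟩ := (hmem j _).1 hj
    rw [cliffordProduct_injective n hAA'] at hA'
    have := Finset.mem_inter.2 ⟨hA, hA'⟩
    rw [h.inter_invariantSets hij, Finset.mem_singleton] at this
    exact hne this
  · obtain ⟨A, hA, hne, rfl⟩ := (hmem j P).1 hP
    obtain ⟨A', hA', hne', hAA'⟩ := hU.exists_conj_eq hA
    have hσ : σ ^ (j + 1).val = σ * σ ^ j.val := by
      rw [add_comm j, pow_val_add h.pow_eq_one, ZMod.val_one, pow_one]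
    rw [show σ * (σ ^ j.val * τ * (σ ^ j.val)⁻¹) * σ⁻¹ =
      (σ * σ ^ j.val) * τ * (σ * σ ^ j.val)⁻¹ by group, ← hσ] at hA'
    have hm : cliffordProduct n A' ∈ C (j + 1) := (hmem _ _).2 ⟨A', hA', hne' hne, rfl⟩
    rcases hAA' with hAA' | hAA'
    · left; rwa [hAA']
    · right; rwa [hAA', neg_neg]
  · obtain ⟨A, hA, -, rfl⟩ := (hmem j P).1 hP
    obtain ⟨μ, hμ⟩ := heig j A hA b
    exact ⟨μ, Module.End.mem_eigenspace_iff.2 hμ, (B j).orthonormal.ne_zero b⟩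
  · exact norm_inner_of_inter_eq (hcard i) (hcard j) (h.inter_invariantSets hij)
      ((B i).orthonormal.1 a) ((B j).orthonormal.1 b) (fun A hA => heig i A hA a)
      (fun A hA => heig j A hA b)
  -- Here U^L = 1 is essential: without the rescaling, the last basis would return to the first only
  -- up to a phase.
  · rw [hB, hB, ← toEuclideanLin_mul_apply, add_comm j, pow_val_add hUL, ZMod.val_one, pow_one]

end IsCyclicPairing

/-! ### Numbering of the points -/

/-- The points of `2m` blocks of length `L` and an additional point, numbered consecutively. -/
theorem exists_equiv_blocks {n m L : ℕ} [NeZero L] (hn : n = L * m) :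
    ∃ e : Option (Fin (2 * m) × ZMod L) ≃ Fin (2 * n + 1),
      (e none : ℕ) = 2 * n ∧ ∀ a x, (e (some (a, x)) : ℕ) = L * a + x.val := by
  have hlt : ∀ (a : Fin (2 * m)) (x : ZMod L), L * (a : ℕ) + x.val < 2 * n := fun a x => by
    have h1 := ZMod.val_lt x
    have h2 : L * ((a : ℕ) + 1) ≤ L * (2 * m) := Nat.mul_le_mul_left L a.2
    rw [mul_add, mul_one] at h2
    have h3 : L * (2 * m) = 2 * n := by rw [hn]; ring
    omega
  let f : Option (Fin (2 * m) × ZMod L) → Fin (2 * n + 1)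
    | none => Fin.last _
    | some (a, x) => ⟨L * a + x.val, (hlt a x).trans (Nat.lt_succ_self _)⟩
  have hf : Function.Bijective f := by
    rw [Fintype.bijective_iff_injective_and_card]
    constructor
    · rintro (_ | ⟨a, x⟩) (_ | ⟨b, y⟩) h
      · rfl
      · exact absurd (Fin.ext_iff.1 h) (hlt b y).ne'
      · exact absurd (Fin.ext_iff.1 h) (hlt a x).ne
      · have h' : L * (a : ℕ) + x.val = L * b + y.val := Fin.ext_iff.1 h
        have hdiv := congrArg (· / L) h'
        have hmod := congrArg (· % L) h'
        simp only [Nat.mul_add_div (NeZero.pos L), Nat.div_eq_of_lt (ZMod.val_lt x),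
          Nat.div_eq_of_lt (ZMod.val_lt y), add_zero] at hdiv
        simp only [Nat.mul_add_mod, Nat.mod_eq_of_lt (ZMod.val_lt x),
          Nat.mod_eq_of_lt (ZMod.val_lt y)] at hmod
        rw [Fin.ext hdiv, ZMod.val_injective L hmod]
    · rw [Fintype.card_option, Fintype.card_prod, Fintype.card_fin, ZMod.card, Fintype.card_fin, hn]
      ring
  exact ⟨Equiv.ofBijective f hf, rfl, fun a x => rfl⟩

theorem cyclesGenerators_of_shiftBlocks {n m L : ℕ} [Fact L.Prime] (hn : n = L * m) (hn0 : 0 < n)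
    {e : Option (Fin (2 * m) × ZMod L) ≃ Fin (2 * n + 1)} (he : (e none : ℕ) = 2 * n)
    (he' : ∀ a x, (e (some (a, x)) : ℕ) = L * a + x.val) {U : Op n}
    (hU : Implements U (e.permCongr (shiftBlocks (2 * m) L))) : CyclesGenerators n L U := by
  have hLpos : 0 < L := (Fact.out : L.Prime).pos
  have hconj : ∀ p, U * Γ n (e p) * Uᴴ = Γ n (e (shiftBlocks (2 * m) L p)) := fun p => by
    rw [hU.conj_Γ, Equiv.permCongr_apply, Equiv.symm_apply_apply]
  refine ⟨fun hL => ?_, fun _ => ⟨fun k hk => ?_, ?_⟩⟩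
  -- The two cases exclude each other: L ∣ n forces L ≤ n < 2n + 1.
  · have : L ≤ n := Nat.le_of_dvd hn0 ⟨m, hn⟩
    omega
  · have hkL : k / L < 2 * m := by
      rw [Nat.div_lt_iff_lt_mul hLpos]
      calc k < 2 * n := hk
        _ = 2 * m * L := by rw [hn]; ring
    have h1 := hconj (some (⟨k / L, hkL⟩, (k : ZMod L)))
    rw [shiftBlocks_some, he', he', ZMod.val_natCast, Nat.div_add_mod] at h1
    rw [h1, blockShift, ZMod.val_add, ZMod.val_natCast, ZMod.val_one]
  · have h1 := hconj none
    rwa [show shiftBlocks (2 * m) L none = none from rfl, he] at h1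

theorem exists_equiv_zmod (n : ℕ) :
    ∃ e : ZMod (2 * n + 1) ≃ Fin (2 * n + 1), ∀ x, (e x : ℕ) = x.val :=
  ⟨(ZMod.finEquiv (2 * n + 1)).symm.toEquiv, fun _ => rfl⟩

theorem cyclesGenerators_of_addRight {n : ℕ} (hn0 : 0 < n)
    {e : ZMod (2 * n + 1) ≃ Fin (2 * n + 1)} (he : ∀ x, (e x : ℕ) = x.val) {U : Op n}
    (hU : Implements U (e.permCongr (Equiv.addRight 1))) : CyclesGenerators n (2 * n + 1) U := by
  have : Fact (1 < 2 * n + 1) := ⟨by omega⟩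
  refine ⟨fun _ k hk => ?_, fun hd => ?_⟩
  · have h1 := hU.conj_Γ (e (k : ZMod (2 * n + 1)))
    rw [Equiv.permCongr_apply, Equiv.symm_apply_apply, he, he, ZMod.val_natCast,
      Nat.mod_eq_of_lt hk] at h1
    rw [h1, Equiv.coe_addRight, ZMod.val_add, ZMod.val_natCast, ZMod.val_one, Nat.mod_eq_of_lt hk]
  · have := Nat.le_of_dvd hn0 hd
    omega

/-- There is a cyclic pairing of the generators whose shift has the required cycles. -/
theorem exists_isCyclicPairing {n L : ℕ} [Fact L.Prime] (hn0 : 0 < n)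
    (h : L ∣ n ∨ L = 2 * n + 1) :
    ∃ (σ τ : Equiv.Perm (Fin (2 * n + 1))) (k : Fin (2 * n + 1)), IsCyclicPairing L σ τ k ∧
      ∀ U : Op n, Implements U σ → CyclesGenerators n L U := by
  rcases h with ⟨m, hn⟩ | rfl
  · have hm : 0 < 2 * m := by
      rcases Nat.eq_zero_or_pos m with rfl | hm
      · simp [hn] at hn0
      · omega
    obtain ⟨e, he, he'⟩ := exists_equiv_blocks hn
    by_cases hL : L = 2
    · subst hL
      exact ⟨_, _, _, (isCyclicPairing_chainPairingFun hm (even_two_mul m)).permCongr e,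
        fun U hU => cyclesGenerators_of_shiftBlocks hn hn0 he he' hU⟩
    · exact ⟨_, _, _, (isCyclicPairing_reflectPairingFun hm hL).permCongr e,
        fun U hU => cyclesGenerators_of_shiftBlocks hn hn0 he he' hU⟩
  · obtain ⟨e, he⟩ := exists_equiv_zmod n
    exact ⟨_, _, _, (isCyclicPairing_neg (L := 2 * n + 1) (by omega)).permCongr e,
      fun U hU => cyclesGenerators_of_addRight hn0 he hU⟩

end CyclicMUB

theorem theorem1 (n L : ℕ) (hL : L.Prime) (hL2 : 2 ≤ L) (hLn : L ≤ 2 * n + 1)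
    (h : L ∣ n ∨ L = 2 * n + 1) :
    ∃ (U : CyclicMUB.Op n) (C : ZMod L → Set (CyclicMUB.Op n))
      (B : ZMod L → OrthonormalBasis (Fin (2 ^ n)) ℂ (CyclicMUB.Qubits n)),
      -- `U` is a unitary that cyclically permutes the Clifford generators
      U ∈ Matrix.unitaryGroup (Fin n → Fin 2) ℂ ∧
      CyclicMUB.CyclesGenerators n L U ∧
      -- the classes consist of `d - 1` commuting Clifford products other than the identity,
      -- among them exactly one generator, and are disjoint
      (∀ j, C j ⊆ CyclicMUB.cliffordProducts n \ {1}) ∧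
      (∀ j, (C j).ncard = 2 ^ n - 1) ∧
      (∀ j, ∀ P ∈ C j, ∀ Q ∈ C j, Commute P Q) ∧
      (∀ j, ∃! k : Fin (2 * n + 1), CyclicMUB.Γ n k ∈ C j) ∧
      (∀ j k, j ≠ k → Disjoint (C j) (C k)) ∧
      -- `U` cyclically permutes the classes, up to the signs of the products
      (∀ j, ∀ P ∈ C j, U * P * U.conjTranspose ∈ C (j + 1) ∨
        -(U * P * U.conjTranspose) ∈ C (j + 1)) ∧
      -- `B j` is a common eigenbasis of the class `C j`
      (∀ j, ∀ P ∈ C j, ∀ b, ∃ μ : ℂ,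
        Module.End.HasEigenvector (Matrix.toEuclideanLin P) μ (B j b)) ∧
      -- the bases are mutually unbiased and are cyclically permuted by `U`
      (∀ j k, j ≠ k → CyclicMUB.MutuallyUnbiased (B j) (B k)) ∧
      (∀ j b, Matrix.toEuclideanLin U (B j b) = B (j + 1) b) := by
  -- The bounds 2 ≤ L ≤ 2n + 1 exclude n = 0.
  have hn : 0 < n := by omega
  have : Fact L.Prime := ⟨hL⟩
  obtain ⟨σ, τ, k, hpair, hcyc⟩ := CyclicMUB.exists_isCyclicPairing hn h
  obtain ⟨U, C, B, hU, hrest⟩ := hpair.exists_classes_bases hL.one_lt hn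
  exact ⟨U, C, B, Matrix.mem_unitaryGroup_iff.2 hU.mul_conjTranspose_self, hcyc U hU, hrest⟩
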